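/- Let $T$ be a tree on $n\ge 3$ vertices, with adjacency matrix $A(T)$ and distance function $d$. For a vertex $v$ put $\operatorname{trs}(v)=\sum_{u\in V(T)}d(u,v)$, and let $$A^{\operatorname{trs}}(T)=\operatorname{diag}(\operatorname{trs}(v))_{v}-A(T),\qquad A^{\operatorname{trs}}_+(T)=\operatorname{diag}(\operatorname{trs}(v))_{v}+A(T).$$ Let $T^l$ be the graph obtained from $T$ by adding one loop at each vertex. A 2-matching of $T^l$ is a set $\mu$ of edges of $T^l$ such that every vertex has at most two incidences with $\mu$, a loop counting as two incidences with its vertex; its size is $|\mu|$, and $l(\mu)$ denotes the set of vertices with loops in $\mu$. A 2-matching $\mu$ is minimal if there is no 2-matching $\nu$ of $T^l$ with $|\nu|=|\mu|$ and $l(\nu)\subsetneq l(\mu)$. For $1\le k\le n$ let $\Delta_k\ge 0$ be the greatest common divisor of the principal minors $\det\big(A^{\operatorname{trs}}(T)_{|l(\mu)}\big)$ over all minimal 2-matchings $\mu$ of $T^l$ of size $k$, where $A^{\operatorname{trs}}(T)_{|S}$ is the submatrix with rows and columns indexed by $S$ and the empty determinant is $1$. Then $\Delta_k>0$ for $3\le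 k\le n$, $\Delta_k\mid\Delta_{k+1}$ for $3\le k<n$, and the Smith normal form over $\mathbb{Z}$ of $A^{\operatorname{trs}}(T)$, and also that of $A^{\operatorname{trs}}_+(T)$, is $$\operatorname{diag}\left(1,1,\Delta_3,\frac{\Delta_4}{\Delta_3},\ldots,\frac{\Delta_n}{\Delta_{n-1}}\right).$$ Moreover, $$\Delta_n=\sum_{a=1}^{n}\ \sum_{U\subseteq V(T),\ |U|=a}\rho(U)\prod_{u\in U}c(u),$$ where $c(u)=\operatorname{trs}(u)-\deg(u)$, and $\rho(U)$ is the number of sets $F\subseteq E(T)$ with $|F|=|U|-1$ that contain at least one edge of the path of $T$ from $u$ to $v$ for all distinct $u,v\in U$. -/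

import Mathlib

noncomputable section

namespace TreeSNF

variable {V : Type*} [Fintype V] [DecidableEq V]

/-- The transmission of a vertex: the sum of its distances to all vertices. -/
def trs (G : SimpleGraph V) (v : V) : ℕ := ∑ u : V, G.dist v u

/-- `A^trs(G) = diag(trs(G)) - A(G)`. -/
def Atrs (G : SimpleGraph V) [DecidableRel G.Adj] : Matrix V V ℤ :=
  Matrix.diagonal (fun v => (trs G v : ℤ)) - G.adjMatrix ℤ

/-- `A^trs_+(G) = diag(trs(G)) + A(G)`. -/
def AtrsPlus (G : SimpleGraph V) [DecidableRel G.Adj] : Matrix V V ℤ :=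
  Matrix.diagonal (fun v => (trs G v : ℤ)) + G.adjMatrix ℤ

/-- The diagonal matrix with entries `d 0, d 1, …, d (n - 1)` is the Smith normal form of the
integer matrix `M`: the entries are nonnegative, each divides the next, and for some enumeration
of the index type `M` becomes this diagonal matrix after multiplication on both sides by
invertible integer matrices. -/
def IsSmithNormalForm {n : ℕ} (M : Matrix V V ℤ) (d : Fin n → ℤ) : Prop :=
  (∀ i, 0 ≤ d i) ∧
  (∀ i j : Fin n, (i : ℕ) + 1 = (j : ℕ) → d i ∣ d j) ∧
  ∃ (e : V ≃ Fin n) (P Q : GL (Fin n) ℤ),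
    (P : Matrix (Fin n) (Fin n) ℤ) * Matrix.reindex e e M * (Q : Matrix (Fin n) (Fin n) ℤ)
      = Matrix.diagonal d

/-- The principal minor of `M` indexed by `S`; it is `1` for empty `S`. -/
def principalMinor (M : Matrix V V ℤ) (S : Finset V) : ℤ :=
  (M.submatrix (Subtype.val : S → V) (Subtype.val : S → V)).det

/-- The number of incidences of the vertex `v` with the edge `e`; the loop at `v` counts twice. -/
def incidences (v : V) (e : Sym2 V) : ℕ :=
  if e = s(v, v) then 2 else if v ∈ e then 1 else 0

/-- `μ` is a 2-matching of the graph obtained from `G` by adding a loop `s(v, v)` at every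
vertex `v`: every member of `μ` is an edge of `G` or a loop, and every vertex has at most two
incidences with `μ`. -/
def IsTwoMatching (G : SimpleGraph V) (μ : Finset (Sym2 V)) : Prop :=
  (∀ e ∈ μ, e ∈ G.edgeSet ∨ e.IsDiag) ∧ ∀ v : V, ∑ e ∈ μ, incidences v e ≤ 2

/-- The set of vertices with loops in `μ`. -/
def loops (μ : Finset (Sym2 V)) : Finset V := Finset.univ.filter fun v => s(v, v) ∈ μ

/-- `μ` is a minimal 2-matching of `G` with loops: no 2-matching with the same number of edges
has a strictly smaller (for inclusion) set of vertices with loops. -/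
def IsMinimalTwoMatching (G : SimpleGraph V) (μ : Finset (Sym2 V)) : Prop :=
  IsTwoMatching G μ ∧
    ∀ ν : Finset (Sym2 V), IsTwoMatching G ν → ν.card = μ.card → ¬ loops ν ⊂ loops μ

open Classical in
/-- The minimal 2-matchings of size `k` of `G` with loops. -/
def minTwoMatchings (G : SimpleGraph V) (k : ℕ) : Finset (Finset (Sym2 V)) :=
  Finset.univ.filter fun μ => IsMinimalTwoMatching G μ ∧ μ.card = k

/-- `Δ_k`: the (nonnegative) greatest common divisor of the principal minors of `A^trs(G)` indexed
by the loop sets of the minimal 2-matchings of size `k`. -/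
def Delta (G : SimpleGraph V) [DecidableRel G.Adj] (k : ℕ) : ℤ :=
  (minTwoMatchings G k).gcd fun μ => principalMinor (Atrs G) (loops μ)

/-- The diagonal entries `1, 1, Δ_3, Δ_4 / Δ_3, …, Δ_n / Δ_(n - 1)`; position `i` is the
`(i + 1)`-st entry. -/
def snfEntries (G : SimpleGraph V) [DecidableRel G.Adj] (n : ℕ) (i : Fin n) : ℤ :=
  if (i : ℕ) < 2 then 1
  else if (i : ℕ) = 2 then Delta G 3
  else Delta G ((i : ℕ) + 1) / Delta G (i : ℕ)

/-- The set of edges of the paths from `u` to `v`; in a tree there is exactly one such path. -/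
def pathEdges (G : SimpleGraph V) (u v : V) : Set (Sym2 V) :=
  {e | ∃ p : G.Walk u v, p.IsPath ∧ e ∈ p.edges}

open Classical in
/-- `ρ(U)`: the number of sets `F` of `|U| - 1` edges that meet the path between any two distinct
vertices of `U`. (It is used for nonempty `U` only.) -/
def rho (G : SimpleGraph V) (U : Finset V) : ℕ :=
  (Finset.univ.filter fun F : Finset (Sym2 V) =>
    (F : Set (Sym2 V)) ⊆ G.edgeSet ∧ F.card + 1 = U.card ∧
      ∀ u ∈ U, ∀ v ∈ U, u ≠ v → (pathEdges G u v ∩ (F : Set (Sym2 V))).Nonempty).card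

/-- `c(u) = trs(u) - deg(u)`. -/
def c (G : SimpleGraph V) [DecidableRel G.Adj] (u : V) : ℤ := (trs G u : ℤ) - (G.degree u : ℤ)

end TreeSNF

end

/-! Let `M` be a symmetric matrix supported on the tree and the diagonal, with entries of absolute
value 1 on tree edges. An edge `xy` is the only connection between its two sides. Consider a minor
with row set `A` and column set `B`, `A ≠ B`, of equal size. Some side `X` of an edge `xy` contains
more of `A` than of `B`. The rows in `A ∩ X` and the columns in `B` outside `X` share at most one
nonzero entry, at `(x, y)`. Hence either a large zero block kills the minor, or the excess is
exactly one and the minor is, up to sign, the product of two minors on the two sides. By induction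
every nonzero minor of order `k` is, up to sign, the principal minor on the loop set of a 2-matching
of size `k` (`absMinor_eq_zero_or_exists_twoMatching`), and every 2-matching of size `k` arises
(`exists_absMinor_eq_of_twoMatching`).

Minimal 2-matchings suffice for the gcd. If a loop set `S` is not minimal, some single loop `w` can
be dropped without losing edges (`exists_isLoopSet_erase`), and then so can the pair `w`, `w'` for
each neighbour `w'` of `w` in `S` (`IsLoopSet.erase_erase`). Expanding the principal minor on `S` at
`w` involves only these smaller loop sets (`dvd_absMinor_self_of_erase`). So `Delta` is the sequence
of determinantal divisors, and the Smith normal form is read off from its successive quotients. The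
two leading ones come from a path with two edges, a loopless 2-matching of size 2.

For the determinant, `A^trs` is the Laplacian plus `diag(c)`. This factors through the incidence
matrix extended by an identity block, and Cauchy-Binet turns the determinant into a sum over pairs
`(U, F)`: the deleted edges `F` leave a spanning forest with one root from `U` in each component,
and the corresponding maximal minor is `±1`. Nonnegativity of `c` then makes the determinant
positive. The matrix with `+A` is conjugate to the one with `-A` by the bipartition signs. -/

set_option linter.unusedSectionVars false

namespace TreeSNF

open Matrix

/-! ### Minors up to sign, indexed by row and column sets -/

section Minors

variable {V W ι : Type*} [DecidableEq V] [DecidableEq W] [Fintype ι] [DecidableEq ι]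

open Classical in
/-- The absolute value of the minor of `M` with row set `A` and column set `B`. -/
noncomputable def absMinor (M : Matrix V W ℤ) (A : Finset V) (B : Finset W) : ℤ :=
  if h : A.card = B.card then
    |(M.submatrix (fun a : A => (a : V)) (fun a : A => (Finset.equivOfCardEq h a : W))).det|
  else 0

/-- Two enumerations of the same row and column sets differ by permutations, which change the
determinant only by a sign; the absolute value makes the minor a function of the sets alone. -/
theorem abs_det_submatrix_eq_absMinor (M : Matrix V W ℤ) {f : ι → V} {g : ι → W}
    (hf : Function.Injective f) (hg : Function.Injective g) :
    |(M.submatrix f g).det| = absMinor M (Finset.univ.image f) (Finset.univ.image g) := by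
  have h : (Finset.univ.image f).card = (Finset.univ.image g).card := by
    rw [Finset.card_image_of_injective _ hf, Finset.card_image_of_injective _ hg]
  unfold absMinor
  rw [dif_pos h]
  let e₁ : ι ≃ Finset.univ.image f := Equiv.ofBijective
    (fun i => ⟨f i, Finset.mem_image_of_mem _ (Finset.mem_univ i)⟩)
    ⟨fun i j hij => hf (by simpa using hij), fun ⟨v, hv⟩ => by
      obtain ⟨i, -, rfl⟩ := Finset.mem_image.1 hv
      exact ⟨i, rfl⟩⟩
  let e₂ : ι ≃ Finset.univ.image g := Equiv.ofBijective
    (fun i => ⟨g i, Finset.mem_image_of_mem _ (Finset.mem_univ i)⟩)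
    ⟨fun i j hij => hg (by simpa using hij), fun ⟨v, hv⟩ => by
      obtain ⟨i, -, rfl⟩ := Finset.mem_image.1 hv
      exact ⟨i, rfl⟩⟩
  rw [← abs_det_submatrix_equiv_equiv e₁ (e₂.trans (Finset.equivOfCardEq h).symm)]
  congr 2
  ext i j
  simp only [submatrix_apply, Equiv.coe_trans, Function.comp_apply, Equiv.apply_symm_apply]
  rfl

theorem abs_det_submatrix_eq_absMinor' (M : Matrix V W ℤ) {f : ι → V} {g : ι → W}
    (hf : Function.Injective f) (hg : Function.Injective g) {A : Finset V} {B : Finset W}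
    (hA : ∀ v, v ∈ A ↔ ∃ i, f i = v) (hB : ∀ v, v ∈ B ↔ ∃ i, g i = v) :
    |(M.submatrix f g).det| = absMinor M A B := by
  rw [abs_det_submatrix_eq_absMinor M hf hg]
  congr 1 <;> ext v <;> simp [hA, hB]

theorem absMinor_eq_zero_of_card_ne (M : Matrix V W ℤ) {A : Finset V} {B : Finset W}
    (h : A.card ≠ B.card) : absMinor M A B = 0 := by
  unfold absMinor
  rw [dif_neg h]

/-- A minor with a zero block of total size exceeding its order vanishes. -/
theorem absMinor_eq_zero_of_zero_block (M : Matrix V W ℤ) {A R : Finset V} {B C : Finset W}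
    (hR : R ⊆ A) (hC : C ⊆ B) (h0 : ∀ r ∈ R, ∀ c ∈ C, M r c = 0)
    (hcard : A.card < R.card + C.card) : absMinor M A B = 0 := by
  by_cases h : A.card = B.card
  swap
  · exact absMinor_eq_zero_of_card_ne M h
  unfold absMinor
  rw [dif_pos h, abs_eq_zero, det_apply]
  refine Finset.sum_eq_zero fun σ _ => ?_
  rw [smul_eq_zero_iff_eq]
  set g : A → W := fun a => (Finset.equivOfCardEq h a : W) with hg
  have hgi : Function.Injective g := fun a b hab => by simpa [hg] using hab
  have hgs : ∀ w ∈ B, ∃ a, g a = w := fun w hw =>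
    ⟨(Finset.equivOfCardEq h).symm ⟨w, hw⟩, by simp [hg]⟩
  -- A nonvanishing term of the Leibniz formula would place the rows `R` and the columns `C` at
  -- disjoint sets of positions, and there are too few positions.
  by_contra hne
  have hne' : ∀ i : A, M (σ i) (g i) ≠ 0 := fun i hi =>
    hne (Finset.prod_eq_zero (Finset.mem_univ i) hi)
  have h1 : (Finset.univ.filter fun i : A => (σ i : V) ∈ R).card = R.card := by
    refine Finset.card_bij (fun i _ => (σ i : V)) (fun i hi => by simpa using hi)
      (fun i _ j _ hij => by simpa using hij) fun r hr => ?_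
    exact ⟨σ.symm ⟨r, hR hr⟩, by simp [hr], by simp⟩
  have h2 : (Finset.univ.filter fun i : A => g i ∈ C).card = C.card := by
    refine Finset.card_bij (fun i _ => g i) (fun i hi => by simpa using hi)
      (fun i _ j _ hij => hgi hij) fun c hc => ?_
    obtain ⟨a, ha⟩ := hgs c (hC hc)
    exact ⟨a, by simp [ha, hc], ha⟩
  have hdisj : Disjoint (Finset.univ.filter fun i : A => (σ i : V) ∈ R)
      (Finset.univ.filter fun i : A => g i ∈ C) := by
    rw [Finset.disjoint_left]
    intro i hi hi'
    simp only [Finset.mem_filter, Finset.mem_univ, true_and] at hi hi'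
    exact hne' i (h0 _ hi _ hi')
  have h3 := Finset.card_le_univ ((Finset.univ.filter fun i : A => (σ i : V) ∈ R) ∪
      (Finset.univ.filter fun i : A => g i ∈ C))
  rw [Finset.card_union_of_disjoint hdisj, h1, h2, Fintype.card_coe] at h3
  omega

/-- The minor of a block lower triangular matrix. -/
theorem absMinor_union (M : Matrix V W ℤ) {A₁ A₂ : Finset V} {B₁ B₂ : Finset W}
    (hA : Disjoint A₁ A₂) (hB : Disjoint B₁ B₂) (h1 : A₁.card = B₁.card) (h2 : A₂.card = B₂.card)
    (h0 : ∀ a ∈ A₁, ∀ b ∈ B₂, M a b = 0) :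
    absMinor M (A₁ ∪ A₂) (B₁ ∪ B₂) = absMinor M A₁ B₁ * absMinor M A₂ B₂ := by
  let f : A₁ ⊕ A₂ → V := Sum.elim (fun a => a) (fun a => a)
  let g : A₁ ⊕ A₂ → W := Sum.elim (fun a => (Finset.equivOfCardEq h1 a : W))
    (fun a => (Finset.equivOfCardEq h2 a : W))
  have hf : Function.Injective f := by
    refine Function.Injective.sumElim Subtype.val_injective Subtype.val_injective fun a b hab => ?_
    exact Finset.disjoint_left.1 hA a.2 (hab ▸ b.2)
  have hg : Function.Injective g := by
    refine Function.Injective.sumElim (fun a b hab => by simpa using hab)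
      (fun a b hab => by simpa using hab) fun a b hab => ?_
    exact Finset.disjoint_left.1 hB (Finset.equivOfCardEq h1 a).2
      (hab ▸ (Finset.equivOfCardEq h2 b).2)
  have key : M.submatrix f g = fromBlocks
      (M.submatrix (fun a : A₁ => (a : V)) (fun a : A₁ => (Finset.equivOfCardEq h1 a : W))) 0
      (M.submatrix (fun a : A₂ => (a : V)) (fun a : A₁ => (Finset.equivOfCardEq h1 a : W)))
      (M.submatrix (fun a : A₂ => (a : V)) (fun a : A₂ => (Finset.equivOfCardEq h2 a : W))) := by
    ext i j
    rcases i with i | i <;> rcases j with j | j <;> simp [f, g]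
    exact h0 _ i.2 _ (Finset.equivOfCardEq h2 j).2
  rw [← abs_det_submatrix_eq_absMinor' M hf hg, key, det_fromBlocks_zero₁₂, abs_mul]
  · unfold absMinor
    rw [dif_pos h1, dif_pos h2]
  · intro v
    simp [f]
  · intro w
    simp only [Finset.mem_union, g, Sum.exists, Sum.elim_inl, Sum.elim_inr]
    refine or_congr ⟨fun hw => ⟨(Finset.equivOfCardEq h1).symm ⟨w, hw⟩, by simp⟩, ?_⟩
      ⟨fun hw => ⟨(Finset.equivOfCardEq h2).symm ⟨w, hw⟩, by simp⟩, ?_⟩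
    · rintro ⟨a, rfl⟩; exact (Finset.equivOfCardEq h1 a).2
    · rintro ⟨a, rfl⟩; exact (Finset.equivOfCardEq h2 a).2

@[simp] theorem absMinor_singleton (M : Matrix V W ℤ) (x : V) (y : W) :
    absMinor M {x} {y} = |M x y| := by
  rw [← abs_det_submatrix_eq_absMinor' M (f := fun _ : Unit => x) (g := fun _ : Unit => y)
    (fun _ _ _ => rfl) (fun _ _ _ => rfl) (by simp [eq_comm]) (by simp [eq_comm])]
  simp

@[simp] theorem absMinor_empty (M : Matrix V W ℤ) : absMinor M ∅ ∅ = 1 := by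
  rw [← abs_det_submatrix_eq_absMinor' M (f := (Empty.elim : Empty → V))
    (g := (Empty.elim : Empty → W)) (fun a => a.elim) (fun a => a.elim) (by simp) (by simp)]
  simp

theorem absMinor_transpose (M : Matrix V W ℤ) (A : Finset V) (B : Finset W) :
    absMinor Mᵀ B A = absMinor M A B := by
  by_cases h : A.card = B.card
  · have h' : absMinor M A B =
      |(M.submatrix (fun a : A => (a : V)) (fun a : A => (Finset.equivOfCardEq h a : W))).det| := by
      unfold absMinor
      rw [dif_pos h]
    rw [h', ← det_transpose, transpose_submatrix, abs_det_submatrix_eq_absMinor']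
    · intro a b hab
      simpa using hab
    · exact Subtype.val_injective
    · exact fun w => ⟨fun hw => ⟨(Finset.equivOfCardEq h).symm ⟨w, hw⟩, by simp⟩, by
        rintro ⟨a, rfl⟩; exact (Finset.equivOfCardEq h a).2⟩
    · simp
  · rw [absMinor_eq_zero_of_card_ne _ h, absMinor_eq_zero_of_card_ne _ (Ne.symm h)]

theorem absMinor_self (M : Matrix V V ℤ) (S : Finset V) :
    absMinor M S S = |principalMinor M S| := by
  unfold principalMinor
  rw [abs_det_submatrix_eq_absMinor' M Subtype.val_injective Subtype.val_injective (A := S) (B := S)]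
  all_goals simp

/-- Divisibility form of the Laplace expansion along the row `w`. -/
theorem dvd_absMinor_of_forall_erase (M : Matrix V W ℤ) {A : Finset V} {B : Finset W} {w : V}
    (hw : w ∈ A) {d : ℤ} (h : ∀ b ∈ B, M w b ≠ 0 → d ∣ absMinor M (A.erase w) (B.erase b)) :
    d ∣ absMinor M A B := by
  by_cases hc : A.card = B.card
  swap
  · rw [absMinor_eq_zero_of_card_ne M hc]; exact dvd_zero d
  obtain ⟨m, hm⟩ : ∃ m, A.card = m + 1 := ⟨A.card - 1, by
    have := Finset.card_pos.2 ⟨w, hw⟩; omega⟩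
  let eA : Fin (m + 1) ≃ A := (Fintype.equivFinOfCardEq (by simp [hm])).symm
  let eB : Fin (m + 1) ≃ B := (Fintype.equivFinOfCardEq (by simp [← hc, hm])).symm
  rw [← abs_det_submatrix_eq_absMinor' M (f := fun i => (eA i : V)) (g := fun i => (eB i : W))
    (fun i j hij => by simpa using hij) (fun i j hij => by simpa using hij)
    (fun v => ⟨fun hv => ⟨eA.symm ⟨v, hv⟩, by simp⟩, by rintro ⟨i, rfl⟩; exact (eA i).2⟩)
    (fun v => ⟨fun hv => ⟨eB.symm ⟨v, hv⟩, by simp⟩, by rintro ⟨i, rfl⟩; exact (eB i).2⟩),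
    dvd_abs, det_succ_row _ (eA.symm ⟨w, hw⟩)]
  refine Finset.dvd_sum fun j _ => ?_
  by_cases hz : M w (eB j) = 0
  · simp [hz]
  refine Dvd.dvd.mul_left ?_ _
  rw [submatrix_submatrix, ← dvd_abs, abs_det_submatrix_eq_absMinor' M (A := A.erase w)
    (B := B.erase (eB j))]
  · exact h _ (eB j).2 hz
  · intro a b hab
    simpa using hab
  · intro a b hab
    simpa using hab
  · intro v
    simp only [Finset.mem_erase, Function.comp_apply]
    constructor
    · rintro ⟨hvw, hv⟩
      obtain ⟨i, hi⟩ := Fin.exists_succAbove_eq (x := eA.symm ⟨v, hv⟩) (y := eA.symm ⟨w, hw⟩)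
        (by simpa using hvw)
      exact ⟨i, by simp [hi]⟩
    · rintro ⟨i, rfl⟩
      refine ⟨fun hi => ?_, (eA _).2⟩
      have : eA.symm ⟨w, hw⟩ = (eA.symm ⟨w, hw⟩).succAbove i := by
        rw [Equiv.symm_apply_eq]
        exact Subtype.ext hi.symm
      exact Fin.succAbove_ne _ _ this.symm
  · intro v
    simp only [Finset.mem_erase, Function.comp_apply]
    constructor
    · rintro ⟨hvw, hv⟩
      obtain ⟨i, hi⟩ := Fin.exists_succAbove_eq (x := eB.symm ⟨v, hv⟩) (y := j)
        (by rw [Ne, Equiv.symm_apply_eq]; exact fun h => hvw (by simp [← h]))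
      exact ⟨i, by simp [hi]⟩
    · rintro ⟨i, rfl⟩
      refine ⟨fun hi => ?_, (eB _).2⟩
      exact Fin.succAbove_ne j i (eB.injective (Subtype.ext hi))

/-- An integer divides all minors of order `k` if and only if it divides the minors formed by
`k` distinct rows and columns. -/
theorem forall_dvd_det_submatrix_iff (M : Matrix V W ℤ) (d : ℤ) (k : ℕ) :
    (∀ (f : Fin k → V) (g : Fin k → W), d ∣ (M.submatrix f g).det) ↔
      ∀ (A : Finset V) (B : Finset W), A.card = k → B.card = k → d ∣ absMinor M A B := by
  constructor
  · intro h A B hA hB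
    have hc : A.card = B.card := hA.trans hB.symm
    let e : Fin k ≃ A := (Fintype.equivFinOfCardEq (by simp [hA])).symm
    unfold absMinor
    rw [dif_pos hc, ← abs_det_submatrix_equiv_equiv e e, dvd_abs]
    exact h _ _
  · intro h f g
    by_cases hf : Function.Injective f
    swap
    · simp only [Function.Injective, not_forall] at hf
      obtain ⟨i, j, hij, hne⟩ := hf
      rw [det_zero_of_row_eq hne (by ext; simp [hij])]
      exact dvd_zero d
    by_cases hg : Function.Injective g
    swap
    · simp only [Function.Injective, not_forall] at hg
      obtain ⟨i, j, hij, hne⟩ := hg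
      rw [det_zero_of_column_eq hne (by simp [hij])]
      exact dvd_zero d
    rw [← dvd_abs, abs_det_submatrix_eq_absMinor M hf hg]
    exact h _ _ (by simp [Finset.card_image_of_injective _ hf])
      (by simp [Finset.card_image_of_injective _ hg])

end Minors

/-! ### Sides of the edges of a tree -/

section Sides

variable {V : Type*} [Fintype V] [DecidableEq V] {T : SimpleGraph V}

/-- `X` is the side of `x` of the bridge `xy`. -/
structure IsSide (T : SimpleGraph V) (x y : V) (X : Finset V) : Prop where
  adj : T.Adj x y
  mem : x ∈ X
  notMem : y ∉ X
  cross : ∀ a ∈ X, ∀ b ∉ X, T.Adj a b → a = x ∧ b = y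

/-- Every edge of a tree is a bridge; the side of `x` is its component after deletion of the edge.
-/
theorem exists_isSide (hT : T.IsTree) {x y : V} (h : T.Adj x y) : ∃ X, IsSide T x y X := by
  classical
  have hb := SimpleGraph.isAcyclic_iff_forall_adj_isBridge.1 hT.isAcyclic h
  rw [SimpleGraph.isBridge_iff] at hb
  refine ⟨Finset.univ.filter fun v => (T.deleteEdges {s(x, y)}).Reachable x v, h, by simp, by
    simpa using hb, fun a ha b hb' hab => ?_⟩
  simp only [Finset.mem_filter, Finset.mem_univ, true_and] at ha hb'
  have he : s(a, b) = s(x, y) := by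
    by_contra hne
    exact hb' (ha.trans (SimpleGraph.Adj.reachable (by simp [hab, hne])))
  rw [Sym2.eq_iff] at he
  rcases he with he | ⟨rfl, rfl⟩
  · exact he
  · exact absurd ha hb

theorem IsSide.compl {x y : V} {X : Finset V} (h : IsSide T x y X) : IsSide T y x Xᶜ :=
  ⟨h.adj.symm, by simpa using h.notMem, by simpa using h.mem, fun a ha b hb hab =>
    (h.cross b (by simpa using hb) a (by simpa using ha) hab.symm).symm⟩

theorem IsSide.mem_support {x y : V} {X : Finset V} (h : IsSide T x y X) {a b : V}
    (p : T.Walk a b) (ha : a ∈ X) (hb : b ∉ X) : x ∈ p.support := by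
  induction p with
  | nil => exact absurd ha hb
  | @cons u v w huv q ih =>
    rw [SimpleGraph.Walk.support_cons, List.mem_cons]
    by_cases hv : v ∈ X
    · exact Or.inr (ih hv hb)
    · exact Or.inl (h.cross u ha v hv huv).1.symm

theorem IsSide.dist_add_dist_le (hT : T.IsTree) {x y : V} {X : Finset V} (h : IsSide T x y X)
    {a b : V} (ha : a ∈ X) (hb : b ∉ X) : T.dist a x + T.dist x b ≤ T.dist a b := by
  obtain ⟨p, hp⟩ := hT.connected.exists_walk_length_eq_dist a b
  have hx := h.mem_support p ha hb
  rw [← hp, ← p.take_spec hx, SimpleGraph.Walk.length_append]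
  exact add_le_add (SimpleGraph.dist_le _) (SimpleGraph.dist_le _)

theorem exists_adj_dist_add_one (hT : T.IsTree) {x v : V} (h : x ≠ v) :
    ∃ x', T.Adj x x' ∧ T.dist x' v + 1 = T.dist x v := by
  obtain ⟨p, hp⟩ := hT.connected.exists_walk_length_eq_dist x v
  cases p with
  | nil => exact absurd rfl h
  | @cons _ u _ hxu q =>
    refine ⟨u, hxu, le_antisymm ?_ ?_⟩
    · rw [← hp, SimpleGraph.Walk.length_cons]
      exact Nat.add_le_add_right (SimpleGraph.dist_le _) 1
    · have := hT.connected.dist_triangle (u := x) (v := u) (w := v)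
      rw [SimpleGraph.dist_eq_one_iff_adj.2 hxu] at this
      omega

theorem IsSide.mem_of_dist_lt (hT : T.IsTree) {x y : V} {X : Finset V} (h : IsSide T x y X) {v : V}
    (hv : T.dist x v < T.dist y v) : v ∈ X := by
  by_contra hvX
  have h1 := h.compl.dist_add_dist_le hT (a := v) (b := x) (by simpa using hvX)
    (by simpa using h.mem)
  rw [T.dist_comm, T.dist_comm (u := v)] at h1
  omega

theorem IsSide.dist_lt_of_mem (hT : T.IsTree) {x y : V} {X : Finset V} (h : IsSide T x y X) {v : V}
    (hv : v ∈ X) : T.dist x v < T.dist y v := by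
  have h1 := h.dist_add_dist_le hT hv h.notMem
  rw [SimpleGraph.dist_eq_one_iff_adj.2 h.adj, T.dist_comm, T.dist_comm (u := v)] at h1
  omega

/-- A function whose sums over the sides of all edges vanish is zero on each side. -/
theorem eq_zero_on_side (hT : T.IsTree) {φ : V → ℤ}
    (hφ : ∀ x y X, IsSide T x y X → ∑ v ∈ X, φ v = 0) (m : ℕ) :
    ∀ x y X, IsSide T x y X → X.card = m → ∀ v ∈ X, φ v = 0 := by
  induction m using Nat.strong_induction_on with
  | _ m ih =>
    intro x y X hX hm
    -- The branch at `x` containing `v` is itself a side, strictly inside `X`, so the induction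
    -- hypothesis applies; the vanishing sum over `X` then handles `x`.
    have hne : ∀ v ∈ X, v ≠ x → φ v = 0 := by
      intro v hv hvx
      obtain ⟨x', hadj, hd⟩ := exists_adj_dist_add_one hT hvx.symm
      obtain ⟨X', hX'⟩ := exists_isSide hT hadj.symm
      have hvX' : v ∈ X' := hX'.mem_of_dist_lt hT (by omega)
      have hx'y : x' ≠ y := by
        rintro rfl
        have := hX.dist_lt_of_mem hT hv
        omega
      have hx' : x' ∈ X := by
        by_contra hx'
        exact hx'y (hX.cross x hX.mem x' hx' hadj).2
      have hsub : X' ⊆ X := by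
        intro w hw
        by_contra hwX
        have h1 := hX.dist_add_dist_le hT hx' hwX
        have h2 := hX'.dist_lt_of_mem hT hw
        have := T.dist_comm (u := x') (v := x)
        omega
      have hlt : X'.card < m := by
        rw [← hm]
        exact Finset.card_lt_card ⟨hsub, fun hs => hX'.notMem (hs hX.mem)⟩
      exact ih _ hlt x' x X' hX' rfl v hvX'
    intro v hv
    by_cases hvx : v = x
    · subst hvx
      rw [← hφ v y X hX, Finset.sum_eq_single_of_mem v hv hne]
    · exact hne v hv hvx

/-- The sums over a side and its complement are opposite, so if none is positive all of them vanish,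
and so does `φ`. Applied to the difference of the indicators of `A` and `B`, this locates the edge
along which a minor splits. -/
theorem exists_side_sum_pos (hT : T.IsTree) {φ : V → ℤ} (hsum : ∑ v, φ v = 0) {a : V}
    (ha : φ a ≠ 0) : ∃ x y X, IsSide T x y X ∧ 0 < ∑ v ∈ X, φ v := by
  by_contra! hcon
  have hz : ∀ x y X, IsSide T x y X → ∑ v ∈ X, φ v = 0 := by
    intro x y X hX
    have h1 := hcon x y X hX
    have h2 := hcon y x Xᶜ hX.compl
    have h3 := Finset.sum_add_sum_compl X φ
    omega
  obtain ⟨b, hb⟩ : ∃ b, b ≠ a := by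
    by_contra! hb
    rw [Finset.sum_eq_single a (fun b _ hba => absurd (hb b) hba) (by simp)] at hsum
    exact ha hsum
  obtain ⟨x', hadj, -⟩ := exists_adj_dist_add_one hT hb.symm
  obtain ⟨X, hX⟩ := exists_isSide hT hadj
  exact ha (eq_zero_on_side hT hz _ a x' X hX rfl a hX.mem)

end Sides

/-! ### 2-matchings and their splicing along an edge -/

section TwoMatchings

variable {V : Type*} [Fintype V] [DecidableEq V] {T : SimpleGraph V}

/-- The number of incidences of `v` with the edges in `μ`. -/
def inc (μ : Finset (Sym2 V)) (v : V) : ℕ := ∑ e ∈ μ, incidences v e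

/-- This form needs no case distinction between edges and loops: at a loop both summands contribute.
-/
theorem incidences_mk (v a b : V) :
    incidences v s(a, b) = (if v = a then 1 else 0) + (if v = b then 1 else 0) := by
  unfold incidences
  by_cases h1 : v = a <;> by_cases h2 : v = b <;> simp_all [eq_comm]

theorem incidences_pos {v : V} {e : Sym2 V} (h : v ∈ e) : 0 < incidences v e := by
  unfold incidences
  split_ifs <;> simp

theorem incidences_eq_zero {v : V} {e : Sym2 V} (h : v ∉ e) : incidences v e = 0 := by
  unfold incidences
  rw [if_neg (by rintro rfl; simp at h), if_neg h]

theorem inc_insert {μ : Finset (Sym2 V)} {e : Sym2 V} (h : e ∉ μ) (v : V) :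
    inc (insert e μ) v = incidences v e + inc μ v := Finset.sum_insert h

theorem inc_insert_le (μ : Finset (Sym2 V)) (e : Sym2 V) (v : V) :
    inc (insert e μ) v ≤ incidences v e + inc μ v := by
  by_cases h : e ∈ μ
  · rw [Finset.insert_eq_of_mem h]; omega
  · rw [inc_insert h]

theorem inc_erase {μ : Finset (Sym2 V)} {e : Sym2 V} (h : e ∈ μ) (v : V) :
    incidences v e + inc (μ.erase e) v = inc μ v := Finset.add_sum_erase μ _ h

theorem inc_union {μ ν : Finset (Sym2 V)} (h : Disjoint μ ν) (v : V) :
    inc (μ ∪ ν) v = inc μ v + inc ν v := Finset.sum_union h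

theorem inc_mono {μ ν : Finset (Sym2 V)} (h : μ ⊆ ν) (v : V) : inc μ v ≤ inc ν v :=
  Finset.sum_le_sum_of_subset h

theorem incidences_le_inc {μ : Finset (Sym2 V)} {e : Sym2 V} (h : e ∈ μ) (v : V) :
    incidences v e ≤ inc μ v := by
  rw [← inc_erase h]; omega

theorem inc_eq_zero_iff {μ : Finset (Sym2 V)} {v : V} : inc μ v = 0 ↔ ∀ e ∈ μ, v ∉ e := by
  unfold inc
  rw [Finset.sum_eq_zero_iff]
  exact forall₂_congr fun e _ => ⟨fun h hv => (incidences_pos hv).ne' h, incidences_eq_zero⟩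

@[simp] theorem mem_loops {μ : Finset (Sym2 V)} {v : V} : v ∈ loops μ ↔ s(v, v) ∈ μ := by
  simp [loops]

theorem IsTwoMatching.inc_le {μ : Finset (Sym2 V)} (h : IsTwoMatching T μ) (v : V) : inc μ v ≤ 2 :=
  h.2 v

theorem IsTwoMatching.mono {μ ν : Finset (Sym2 V)} (h : IsTwoMatching T ν) (hs : μ ⊆ ν) :
    IsTwoMatching T μ :=
  ⟨fun e he => h.1 e (hs he), fun v => (inc_mono hs v).trans (h.2 v)⟩

theorem inc_erase_loop {μ : Finset (Sym2 V)} (h : IsTwoMatching T μ) {v : V} (hv : s(v, v) ∈ μ) :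
    inc (μ.erase s(v, v)) v = 0 := by
  have h1 := inc_erase hv v
  have h2 := h.inc_le v
  rw [incidences_mk] at h1
  simp only [if_true] at h1
  omega

/-- A loop uses up both incidences of its vertex. -/
theorem IsTwoMatching.eq_loop {μ : Finset (Sym2 V)} (h : IsTwoMatching T μ) {v : V}
    (hv : s(v, v) ∈ μ) {e : Sym2 V} (he : e ∈ μ) (hve : v ∈ e) : e = s(v, v) := by
  by_contra hne
  exact inc_eq_zero_iff.1 (inc_erase_loop h hv) e (Finset.mem_erase.2 ⟨hne, he⟩) hve

/-- Joining two vertices with a free incidence. -/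
theorem IsTwoMatching.insert_edge {μ : Finset (Sym2 V)} (h : IsTwoMatching T μ) {a b : V}
    (hab : T.Adj a b) (ha : inc μ a ≤ 1) (hb : inc μ b ≤ 1) :
    IsTwoMatching T (insert s(a, b) μ) := by
  refine ⟨fun e he => ?_, fun v => ?_⟩
  · rcases Finset.mem_insert.1 he with rfl | he
    · exact Or.inl hab
    · exact h.1 e he
  · refine (inc_insert_le μ s(a, b) v).trans ?_
    rw [incidences_mk]
    have h2 := h.inc_le v
    have hne := hab.ne
    by_cases h1 : v = a
    · subst h1
      rw [if_pos rfl, if_neg hne]; omega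
    · by_cases h3 : v = b
      · subst h3
        rw [if_pos rfl, if_neg h1]; omega
      · rw [if_neg h1, if_neg h3]; omega

theorem loops_insert_edge {μ : Finset (Sym2 V)} {a b : V} (hab : a ≠ b) :
    loops (insert s(a, b) μ) = loops μ := by
  ext v
  simp only [mem_loops, Finset.mem_insert, or_iff_right_iff_imp]
  intro h
  rw [Sym2.eq_iff] at h
  rcases h with ⟨rfl, rfl⟩ | ⟨rfl, rfl⟩ <;> exact absurd rfl hab

theorem loops_erase_loop (μ : Finset (Sym2 V)) (v : V) :
    loops (μ.erase s(v, v)) = (loops μ).erase v := by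
  ext w
  simp

/-- The edges in `μ` with both ends in `X`. -/
def restrict (μ : Finset (Sym2 V)) (X : Finset V) : Finset (Sym2 V) :=
  μ.filter fun e => ∀ v, v ∈ e → v ∈ X

theorem mem_restrict {μ : Finset (Sym2 V)} {X : Finset V} {e : Sym2 V} :
    e ∈ restrict μ X ↔ e ∈ μ ∧ ∀ v, v ∈ e → v ∈ X := by simp [restrict]

theorem restrict_subset (μ : Finset (Sym2 V)) (X : Finset V) : restrict μ X ⊆ μ :=
  Finset.filter_subset _ _

theorem inc_restrict_of_notMem (μ : Finset (Sym2 V)) {X : Finset V} {v : V} (hv : v ∉ X) :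
    inc (restrict μ X) v = 0 :=
  inc_eq_zero_iff.2 fun _ he hve => hv ((mem_restrict.1 he).2 v hve)

theorem disjoint_restrict (μ ν : Finset (Sym2 V)) {X Y : Finset V} (h : Disjoint X Y) :
    Disjoint (restrict μ X) (restrict ν Y) := by
  rw [Finset.disjoint_left]
  intro e he he'
  induction e with
  | _ a b =>
    exact Finset.disjoint_left.1 h ((mem_restrict.1 he).2 a (by simp))
      ((mem_restrict.1 he').2 a (by simp))

theorem loops_restrict (μ : Finset (Sym2 V)) (X : Finset V) :
    loops (restrict μ X) = loops μ ∩ X := by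
  ext v
  simp [mem_restrict]

theorem loops_union (μ ν : Finset (Sym2 V)) : loops (μ ∪ ν) = loops μ ∪ loops ν := by
  ext v
  simp

/-- The edges of `μ` on one side of a cut together with the edges of `ν` on the other side. -/
def splice (μ ν : Finset (Sym2 V)) (X : Finset V) : Finset (Sym2 V) :=
  restrict μ X ∪ restrict ν Xᶜ

theorem card_splice (μ ν : Finset (Sym2 V)) (X : Finset V) :
    (splice μ ν X).card = (restrict μ X).card + (restrict ν Xᶜ).card :=
  Finset.card_union_of_disjoint (disjoint_restrict _ _ disjoint_compl_right)

theorem inc_splice (μ ν : Finset (Sym2 V)) (X : Finset V) (v : V) :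
    inc (splice μ ν X) v = inc (restrict μ X) v + inc (restrict ν Xᶜ) v :=
  inc_union (disjoint_restrict _ _ disjoint_compl_right) v

theorem inc_splice_of_mem (μ ν : Finset (Sym2 V)) {X : Finset V} {v : V} (hv : v ∈ X) :
    inc (splice μ ν X) v = inc (restrict μ X) v := by
  rw [inc_splice, inc_restrict_of_notMem ν (by simpa using hv), add_zero]

theorem inc_splice_of_notMem (μ ν : Finset (Sym2 V)) {X : Finset V} {v : V} (hv : v ∉ X) :
    inc (splice μ ν X) v = inc (restrict ν Xᶜ) v := by
  rw [inc_splice, inc_restrict_of_notMem μ hv, zero_add]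

theorem loops_splice (μ ν : Finset (Sym2 V)) (X : Finset V) :
    loops (splice μ ν X) = loops μ ∩ X ∪ loops ν ∩ Xᶜ := by
  rw [splice, loops_union, loops_restrict, loops_restrict]

theorem IsTwoMatching.splice {μ ν : Finset (Sym2 V)} (hμ : IsTwoMatching T μ)
    (hν : IsTwoMatching T ν) (X : Finset V) : IsTwoMatching T (splice μ ν X) := by
  refine ⟨fun e he => ?_, fun v => ?_⟩
  · rcases Finset.mem_union.1 he with he | he
    · exact hμ.1 e (restrict_subset _ _ he)
    · exact hν.1 e (restrict_subset _ _ he)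
  · change inc (TreeSNF.splice μ ν X) v ≤ 2
    by_cases hv : v ∈ X
    · rw [inc_splice_of_mem _ _ hv]
      exact (inc_mono (restrict_subset _ _) v).trans (hμ.inc_le v)
    · rw [inc_splice_of_notMem _ _ hv]
      exact (inc_mono (restrict_subset _ _) v).trans (hν.inc_le v)

/-- Only the edge `xy` can have ends on both sides. -/
theorem IsSide.erase_eq_splice {x y : V} {X : Finset V} (h : IsSide T x y X) {μ : Finset (Sym2 V)}
    (hμ : IsTwoMatching T μ) : μ.erase s(x, y) = splice μ μ X := by
  ext e
  induction e with
  | _ a b =>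
    simp only [Finset.mem_erase, TreeSNF.splice, Finset.mem_union, mem_restrict, Sym2.mem_iff,
      forall_eq_or_imp, forall_eq, Finset.mem_compl]
    constructor
    · rintro ⟨hne, hab⟩
      have hor : a = b ∨ T.Adj a b := by
        rcases hμ.1 _ hab with h' | h'
        · exact Or.inr h'
        · exact Or.inl (Sym2.mk_isDiag_iff.1 h')
      by_cases ha : a ∈ X <;> by_cases hb : b ∈ X
      · exact Or.inl ⟨hab, ha, hb⟩
      · rcases hor with rfl | hadj
        · exact absurd ha hb
        · obtain ⟨rfl, rfl⟩ := h.cross a ha b hb hadj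
          exact absurd rfl hne
      · rcases hor with rfl | hadj
        · exact absurd hb ha
        · obtain ⟨rfl, rfl⟩ := h.cross b hb a ha hadj.symm
          exact absurd Sym2.eq_swap hne
      · exact Or.inr ⟨hab, ha, hb⟩
    · rintro (⟨hab, ha, hb⟩ | ⟨hab, ha, hb⟩) <;> refine ⟨fun he => ?_, hab⟩ <;>
        rw [Sym2.eq_iff] at he <;> rcases he with ⟨rfl, rfl⟩ | ⟨rfl, rfl⟩
      · exact h.notMem hb
      · exact h.notMem ha
      · exact ha h.mem
      · exact hb h.mem

theorem IsSide.card_eq {x y : V} {X : Finset V} (h : IsSide T x y X) {μ : Finset (Sym2 V)}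
    (hμ : IsTwoMatching T μ) : μ.card =
      (restrict μ X).card + (restrict μ Xᶜ).card + if s(x, y) ∈ μ then 1 else 0 := by
  rw [← card_splice, ← h.erase_eq_splice hμ]
  split_ifs with he
  · exact (Finset.card_erase_add_one he).symm
  · rw [Finset.erase_eq_of_notMem he, add_zero]

/-- Restricting to a side frees an incidence at the end of a cut edge. -/
theorem IsSide.inc_restrict_le {x y : V} {X : Finset V} (h : IsSide T x y X)
    {μ : Finset (Sym2 V)} (hμ : IsTwoMatching T μ) (he : s(x, y) ∈ μ) :
    inc (restrict μ X) x ≤ 1 := by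
  have h1 := inc_erase he x
  have h2 := hμ.inc_le x
  rw [h.erase_eq_splice hμ, inc_splice_of_mem _ _ h.mem, incidences_mk, if_pos rfl,
    if_neg h.adj.ne] at h1
  omega

end TwoMatchings

/-! ### Exchange properties of loop sets -/

section Exchange

variable {V : Type*} [Fintype V] [DecidableEq V] {T : SimpleGraph V}

/-- `S` is the loop set of a 2-matching with at least `k` edges. -/
def IsLoopSet (T : SimpleGraph V) (k : ℕ) (S : Finset V) : Prop :=
  ∃ μ, IsTwoMatching T μ ∧ loops μ = S ∧ k ≤ μ.card

/-- If the loop sets of two 2-matchings are nested, then a single loop can be removed from the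
larger one without loss of edges. -/
theorem exists_isLoopSet_erase (hT : T.IsTree) {k : ℕ} {S : Finset V} (hS : IsLoopSet T k S)
    (m : ℕ) : ∀ S' ⊂ S, IsLoopSet T k S' → (S \ S').card = m + 1 →
      ∃ w ∈ S, IsLoopSet T k (S.erase w) := by
  induction m with
  | zero =>
    intro S' hS' h hc
    obtain ⟨w, hw⟩ := Finset.card_eq_one.1 (by simpa using hc)
    have hwS : w ∈ S \ S' := by rw [hw]; simp
    refine ⟨w, (Finset.mem_sdiff.1 hwS).1, ?_⟩
    rwa [← Finset.sdiff_singleton_eq_erase, ← hw, Finset.sdiff_sdiff_eq_self hS'.1]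
  | succ m ih =>
    intro S' hS' hν hc
    obtain ⟨μ, hμ, rfl, hμk⟩ := hS
    obtain ⟨ν, hν, rfl, hνk⟩ := hν
    obtain ⟨r₀, hr₀⟩ : (loops μ \ loops ν).Nonempty := by
      rw [← Finset.card_pos]; omega
    -- The vertex `r` is chosen in the difference farthest from `r₀`, and `X` is its side away from
    -- `r₀`. Then `r` is the only vertex of the difference in `X`.
    obtain ⟨r, hr, hmax⟩ := Finset.exists_max_image _ (fun v => T.dist v r₀) ⟨r₀, hr₀⟩
    have hne : r ≠ r₀ := by
      rintro rfl
      obtain ⟨a, ha, hb⟩ := Finset.exists_mem_ne (by omega : 1 < (loops μ \ loops ν).card) r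
      have := hmax a ha
      rw [SimpleGraph.dist_self, Nat.le_zero, hT.connected.dist_eq_zero_iff] at this
      exact hb this
    obtain ⟨p, hrp, hp⟩ := exists_adj_dist_add_one hT hne
    obtain ⟨X, hX⟩ := exists_isSide hT hrp
    have hr₀X : r₀ ∉ X := fun h => by
      have := hX.dist_lt_of_mem hT h
      omega
    have hXR : ∀ v ∈ X, v ∈ loops μ → v ∉ loops ν → v = r := by
      intro v hv hvμ hvν
      have h1 := hX.dist_add_dist_le hT hv hr₀X
      have h2 := hmax v (Finset.mem_sdiff.2 ⟨hvμ, hvν⟩)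
      exact hT.connected.dist_eq_zero_iff.1 (by omega)
    have hrμ := (Finset.mem_sdiff.1 hr).1
    have hrν := (Finset.mem_sdiff.1 hr).2
    have hrpμ : s(r, p) ∉ μ := fun h => by
      have := hμ.eq_loop (mem_loops.1 hrμ) h (by simp)
      rw [Sym2.eq_iff] at this
      rcases this with ⟨-, h⟩ | ⟨-, h⟩ <;> exact hrp.ne h.symm
    have hcμ := hX.card_eq hμ
    rw [if_neg hrpμ] at hcμ
    have hcν : ν.card ≤ (restrict ν X).card + (restrict ν Xᶜ).card + 1 := by
      rw [hX.card_eq hν]; split_ifs <;> omega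
    have hsub := hS'.1
    -- If `ν` is at least as large as `μ` inside `X`, using `ν` there removes exactly the loop at
    -- `r`. Otherwise using `μ` inside `X` gains an edge, which pays for the possible loss of `rp`
    -- from `ν`; this adds `r` to the smaller loop set, and the difference shrinks.
    by_cases hcmp : (restrict μ X).card ≤ (restrict ν X).card
    · refine ⟨r, hrμ, splice ν μ X, hν.splice hμ X, ?_, ?_⟩
      · rw [loops_splice]
        ext v
        simp only [Finset.mem_union, Finset.mem_inter, Finset.mem_compl, Finset.mem_erase]
        constructor
        · rintro (⟨h1, h2⟩ | ⟨h1, h2⟩)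
          · exact ⟨fun h => hrν (h ▸ h1), hsub h1⟩
          · exact ⟨fun h => h2 (h ▸ hX.mem), h1⟩
        · rintro ⟨h1, h2⟩
          by_cases hv : v ∈ X
          · exact Or.inl ⟨by_contra fun h => h1 (hXR v hv h2 h), hv⟩
          · exact Or.inr ⟨h2, hv⟩
      · rw [card_splice]; omega
    · have hloops : loops (splice μ ν X) = insert r (loops ν) := by
        rw [loops_splice]
        ext v
        simp only [Finset.mem_union, Finset.mem_inter, Finset.mem_compl, Finset.mem_insert]
        constructor
        · rintro (⟨h1, h2⟩ | ⟨h1, h2⟩)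
          · by_cases h : v ∈ loops ν
            · exact Or.inr h
            · exact Or.inl (hXR v h2 h1 h)
          · exact Or.inr h1
        · rintro (rfl | h1)
          · exact Or.inl ⟨hrμ, hX.mem⟩
          · by_cases hv : v ∈ X
            · exact Or.inl ⟨hsub h1, hv⟩
            · exact Or.inr ⟨h1, hv⟩
      have hcard : (loops μ \ insert r (loops ν)).card = m + 1 := by
        rw [Finset.sdiff_insert, Finset.card_erase_of_mem hr, hc]
        rfl
      refine ih (insert r (loops ν)) ?_ ⟨splice μ ν X, hμ.splice hν X, hloops, ?_⟩ hcard
      · refine (Finset.ssubset_iff_subset_ne).2 ⟨Finset.insert_subset hrμ hsub, fun h => ?_⟩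
        rw [h, Finset.sdiff_self] at hcard
        simp at hcard
      · rw [card_splice]; omega

/-- Deleting the loop at `w'` frees `w'`, so the edge `ww'` can take its place. -/
theorem IsLoopSet.exchange_loop {k : ℕ} {ξ : Finset (Sym2 V)} {w w' : V} (hξ : IsTwoMatching T ξ)
    (hk : k ≤ ξ.card) (hadj : T.Adj w w') (hw : inc ξ w ≤ 1) (hw' : s(w', w') ∈ ξ) :
    IsLoopSet T k ((loops ξ).erase w') := by
  have h1 : IsTwoMatching T (ξ.erase s(w', w')) := hξ.mono (Finset.erase_subset _ _)
  refine ⟨insert s(w, w') (ξ.erase s(w', w')), h1.insert_edge hadj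
    ((inc_mono (Finset.erase_subset _ _) w).trans hw) (by rw [inc_erase_loop hξ hw']; omega), ?_, ?_⟩
  · rw [loops_insert_edge hadj.ne, loops_erase_loop]
  · rw [Finset.card_insert_of_notMem, Finset.card_erase_add_one hw']
    · exact hk
    · intro h
      have := inc_eq_zero_iff.1 (inc_erase_loop hξ hw') _ h
      simp at this

/-- If the loop at `w` can be removed from a loop set without loss of edges, then so can the loops
at `w` and an adjacent vertex. -/
theorem IsLoopSet.erase_erase (hT : T.IsTree) {k : ℕ} {S : Finset V} (hS : IsLoopSet T k S)
    {w w' : V} (hw : w ∈ S) (hSw : IsLoopSet T k (S.erase w)) (hw' : w' ∈ S)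
    (hadj : T.Adj w w') : IsLoopSet T k ((S.erase w).erase w') := by
  obtain ⟨μ, hμ, rfl, hμk⟩ := hS
  obtain ⟨ν, hν, hνl, hνk⟩ := hSw
  have hw'ν : s(w', w') ∈ ν := by
    rw [← mem_loops, hνl]
    exact Finset.mem_erase.2 ⟨hadj.ne', hw'⟩
  have hwν : s(w, w) ∉ ν := by
    rw [← mem_loops, hνl]
    simp
  by_cases h1 : inc ν w ≤ 1
  · rw [← hνl]
    exact IsLoopSet.exchange_loop hν hνk hadj h1 hw'ν
  -- Now `w` is saturated in `ν` without a loop, so `ν` has an edge `wu`. The two 2-matchings are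
  -- cut along this edge, with `X` the side of `u`.
  obtain ⟨e, he, hwe⟩ : ∃ e ∈ ν, w ∈ e := by
    by_contra! h
    exact h1 (by rw [inc_eq_zero_iff.2 h]; omega)
  obtain ⟨u, rfl⟩ := Sym2.mem_iff_exists.1 hwe
  have hwu : T.Adj w u := by
    rcases hν.1 _ he with h | h
    · exact h
    · rw [Sym2.mk_isDiag_iff] at h
      subst h
      exact absurd he hwν
  have hue : s(u, w) ∈ ν := by rwa [Sym2.eq_swap]
  obtain ⟨X, hX⟩ := exists_isSide hT hwu.symm
  have huw' : u ≠ w' := by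
    rintro rfl
    have := hν.eq_loop hw'ν hue (by simp)
    rw [Sym2.eq_iff] at this
    rcases this with ⟨-, h⟩ | ⟨-, h⟩ <;> exact hadj.ne h
  have hw'X : w' ∉ X := fun h => huw' (hX.cross w' h w hX.notMem hadj.symm).1.symm
  have hcν := hX.card_eq hν
  rw [if_pos hue] at hcν
  have hcμ := hX.card_eq hμ
  have huμ : s(u, w) ∉ μ := fun h => by
    have := hμ.eq_loop (mem_loops.1 hw) h (by simp)
    rw [Sym2.eq_iff] at this
    rcases this with ⟨h, -⟩ | ⟨h, -⟩ <;> exact hwu.ne h.symm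
  rw [if_neg huμ] at hcμ
  -- Here `μ` replaces `ν` on `X`: the gain there covers the loss of `uw`, and `w` obtains a free
  -- incidence.
  by_cases hcmp : (restrict ν X).card < (restrict μ X).card
  · have hl : loops (splice μ ν X) = (loops μ).erase w := by
      rw [loops_splice, hνl]
      ext v
      have : v ∈ X → v ≠ w := fun h h' => hX.notMem (h' ▸ h)
      simp only [Finset.mem_union, Finset.mem_inter, Finset.mem_compl, Finset.mem_erase]
      tauto
    rw [← hl]
    refine IsLoopSet.exchange_loop (hμ.splice hν X) (by rw [card_splice]; omega) hadj ?_ ?_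
    · rw [inc_splice_of_notMem _ _ hX.notMem]
      exact hX.compl.inc_restrict_le hν he
    · rw [← mem_loops, hl]
      exact Finset.mem_erase.2 ⟨hadj.ne', hw'⟩
  -- Here `ν` replaces `μ` on `X`, which keeps all loops and leaves an incidence free at `u`.
  -- Trading the loop at `w` for `wu` frees one incidence at `w`, so the loop at `w'` can be traded
  -- for `ww'`.
  · have hl : loops (splice ν μ X) = loops μ := by
      rw [loops_splice, hνl]
      ext v
      have : v ∈ X → v ≠ w := fun h h' => hX.notMem (h' ▸ h)
      simp only [Finset.mem_union, Finset.mem_inter, Finset.mem_compl, Finset.mem_erase]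
      tauto
    have hξ := hν.splice hμ X
    set ξ := splice ν μ X with hξd
    have hwξ : s(w, w) ∈ ξ := by rw [← mem_loops, hl]; exact hw
    have huξ : inc ξ u ≤ 1 := by
      rw [inc_splice_of_mem _ _ hX.mem]
      exact hX.inc_restrict_le hν hue
    have h0 := inc_erase_loop hξ hwξ
    have hη : IsTwoMatching T (insert s(w, u) (ξ.erase s(w, w))) :=
      (hξ.mono (Finset.erase_subset _ _)).insert_edge hwu (by omega)
        ((inc_mono (Finset.erase_subset _ _) u).trans huξ)
    have hlη : loops (insert s(w, u) (ξ.erase s(w, w))) = (loops μ).erase w := by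
      rw [loops_insert_edge hwu.ne, loops_erase_loop, hl]
    rw [← hlη]
    refine IsLoopSet.exchange_loop hη ?_ hadj ?_ ?_
    · rw [Finset.card_insert_of_notMem, Finset.card_erase_add_one hwξ, hξd, card_splice]
      · omega
      · intro h
        have := inc_eq_zero_iff.1 h0 _ h
        simp at this
    · refine (inc_insert_le _ _ _).trans ?_
      rw [h0, incidences_mk, if_pos rfl, if_neg hwu.ne]
    · rw [← mem_loops, hlη]
      exact Finset.mem_erase.2 ⟨hadj.ne', hw'⟩

end Exchange

/-! ### Minors of tree matrices and 2-matchings -/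

section TreeMinors

variable {V : Type*} [Fintype V] [DecidableEq V] {T : SimpleGraph V} {M : Matrix V V ℤ}

/-- `M` is symmetric with off-diagonal support `T` and off-diagonal entries of absolute value at
most one. -/
structure IsGraphMatrix (T : SimpleGraph V) (M : Matrix V V ℤ) : Prop where
  transpose : Mᵀ = M
  adj : ∀ a b, T.Adj a b → |M a b| = 1
  not_adj : ∀ a b, a ≠ b → ¬ T.Adj a b → M a b = 0

theorem IsSide.apply_eq_zero {x y : V} {X : Finset V} (h : IsSide T x y X)
    (hM : IsGraphMatrix T M) {a b : V} (ha : a ∈ X) (hb : b ∉ X) (hne : a ≠ x ∨ b ≠ y) :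
    M a b = 0 := by
  refine hM.not_adj a b (fun hab => hb (hab ▸ ha)) fun hab => ?_
  have := h.cross a ha b hb hab
  tauto

/-- A minor using a tree edge as the only connection between its sides is a product. -/
theorem IsSide.absMinor_insert {x y : V} {X : Finset V} (h : IsSide T x y X)
    (hM : IsGraphMatrix T M) {A₁ A₂ B₁ B₂ : Finset V} (hA₁ : A₁ ⊆ X) (hB₁ : B₁ ⊆ X)
    (hA₂ : A₂ ⊆ Xᶜ) (hB₂ : B₂ ⊆ Xᶜ) (hx : x ∉ A₁) (hy : y ∉ B₂) (h1 : A₁.card = B₁.card)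
    (h2 : A₂.card = B₂.card) :
    absMinor M (insert x (A₁ ∪ A₂)) (insert y (B₁ ∪ B₂)) =
      absMinor M A₁ B₁ * absMinor M A₂ B₂ := by
  have hxA₂ : x ∉ A₂ := fun hx' => by simpa using hA₂ hx' |> Finset.mem_compl.1 |> (· h.mem)
  have hyB₁ : y ∉ B₁ := fun hy' => h.notMem (hB₁ hy')
  have dA : Disjoint A₁ A₂ :=
    Finset.disjoint_of_subset_left hA₁ (Finset.disjoint_of_subset_right hA₂ disjoint_compl_right)
  have dB : Disjoint B₁ B₂ :=
    Finset.disjoint_of_subset_left hB₁ (Finset.disjoint_of_subset_right hB₂ disjoint_compl_right)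
  -- In this order the matrix is block lower triangular, with diagonal blocks `A₁ × B₁`, the entry
  -- at `(x, y)` and `A₂ × B₂`.
  have eA : insert x (A₁ ∪ A₂) = A₁ ∪ ({x} ∪ A₂) := by ext; simp
  have eB : insert y (B₁ ∪ B₂) = B₁ ∪ ({y} ∪ B₂) := by ext; simp
  rw [eA, eB, absMinor_union, absMinor_union, absMinor_singleton, hM.adj _ _ h.adj, one_mul]
  · simpa using hxA₂
  · simpa using hy
  · simp
  · exact h2
  · intro a ha b hb
    rw [Finset.mem_singleton] at ha
    subst ha
    exact h.apply_eq_zero hM h.mem (by simpa using hB₂ hb) (Or.inr fun h' => hy (h' ▸ hb))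
  · simp [dA, hx]
  · simp [dB, hyB₁]
  · exact h1
  · rw [Finset.card_union_of_disjoint (by simpa using hxA₂),
      Finset.card_union_of_disjoint (by simpa using hy), h2]
    simp
  · intro a ha b hb
    refine h.apply_eq_zero hM (hA₁ ha) ?_ (Or.inl fun h' => hx (h' ▸ ha))
    rcases Finset.mem_union.1 hb with hb | hb
    · rw [Finset.mem_singleton.1 hb]; exact h.notMem
    · simpa using hB₂ hb

/-- Principal minors of separated vertex sets multiply. -/
theorem IsSide.absMinor_union_self {x y : V} {X : Finset V} (h : IsSide T x y X)
    (hM : IsGraphMatrix T M) {S₁ S₂ : Finset V} (h1 : S₁ ⊆ X) (h2 : S₂ ⊆ Xᶜ)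
    (hx : x ∉ S₁ ∨ y ∉ S₂) :
    absMinor M (S₁ ∪ S₂) (S₁ ∪ S₂) = absMinor M S₁ S₁ * absMinor M S₂ S₂ := by
  have d : Disjoint S₁ S₂ :=
    Finset.disjoint_of_subset_left h1 (Finset.disjoint_of_subset_right h2 disjoint_compl_right)
  refine absMinor_union M d d rfl rfl fun a ha b hb => ?_
  refine h.apply_eq_zero hM (h1 ha) (by simpa using h2 hb) (hx.imp ?_ ?_)
  · rintro h' rfl; exact h' ha
  · rintro h' rfl; exact h' hb

theorem card_inter_add_card_inter_compl (A X : Finset V) : (A ∩ X).card + (A ∩ Xᶜ).card = A.card := by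
  rw [← Finset.card_union_of_disjoint, ← Finset.inter_union_distrib_left, Finset.union_compl,
    Finset.inter_univ]
  exact Finset.disjoint_of_subset_left Finset.inter_subset_right
    (Finset.disjoint_of_subset_right Finset.inter_subset_right disjoint_compl_right)

theorem inc_loopSet (S : Finset V) (v : V) :
    inc (S.image fun v => s(v, v)) v = if v ∈ S then 2 else 0 := by
  unfold inc
  rw [Finset.sum_image (fun a _ b _ hab => by simpa [Sym2.eq_iff] using hab)]
  simp only [incidences_mk]
  split_ifs with h
  · rw [Finset.sum_eq_single_of_mem v h (fun b _ hb => by simp [hb.symm])]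
    simp
  · refine Finset.sum_eq_zero fun b hb => ?_
    have : v ≠ b := fun h' => h (h' ▸ hb)
    simp [this]

theorem subset_of_inc_zero {μ : Finset (Sym2 V)} {X : Finset V} (h : ∀ v ∉ X, inc μ v = 0) :
    ∀ e ∈ μ, ∀ v, v ∈ e → v ∈ X := by
  intro e he v hv
  by_contra hvX
  exact inc_eq_zero_iff.1 (h v hvX) e he hv

/-- Assembling 2-matchings on both sides of an edge, joined by this edge. -/
theorem IsSide.join {x y : V} {X : Finset V} (h : IsSide T x y X) {μ₁ μ₂ : Finset (Sym2 V)}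
    (h₁ : ∀ v ∉ X, inc μ₁ v = 0) (h₂ : ∀ v ∈ X, inc μ₂ v = 0) :
    (insert s(x, y) (μ₁ ∪ μ₂)).card = μ₁.card + μ₂.card + 1 ∧
    (∀ v, inc (insert s(x, y) (μ₁ ∪ μ₂)) v =
      ((if v = x then 1 else 0) + (if v = y then 1 else 0)) + (inc μ₁ v + inc μ₂ v)) ∧
    loops (insert s(x, y) (μ₁ ∪ μ₂)) = loops μ₁ ∪ loops μ₂ := by
  have hX₁ := subset_of_inc_zero h₁
  have hX₂ : ∀ e ∈ μ₂, ∀ v, v ∈ e → v ∈ Xᶜ := subset_of_inc_zero (by simpa using h₂)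
  have hd : Disjoint μ₁ μ₂ := by
    rw [Finset.disjoint_left]
    intro e he he'
    induction e with
    | _ a b => exact Finset.mem_compl.1 (hX₂ _ he' a (by simp)) (hX₁ _ he a (by simp))
  have hn : s(x, y) ∉ μ₁ ∪ μ₂ := by
    intro he
    rcases Finset.mem_union.1 he with he | he
    · exact h.notMem (hX₁ _ he y (by simp))
    · exact Finset.mem_compl.1 (hX₂ _ he x (by simp)) h.mem
  refine ⟨?_, fun v => ?_, ?_⟩
  · rw [Finset.card_insert_of_notMem hn, Finset.card_union_of_disjoint hd]
  · rw [inc_insert hn, inc_union hd, incidences_mk]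
  · rw [loops_insert_edge h.adj.ne, loops_union]

/-- A loop needs two incidences, one allowed by `A` and one by `B`. -/
theorem loops_subset_of_inc {μ : Finset (Sym2 V)} {A B : Finset V}
    (h : ∀ v, inc μ v ≤ (if v ∈ A then 1 else 0) + (if v ∈ B then 1 else 0)) :
    loops μ ⊆ A ∩ B := by
  intro v hv
  have h1 := incidences_le_inc (mem_loops.1 hv) v
  have h2 := h v
  rw [incidences_mk] at h1
  simp only [if_true] at h1
  rw [Finset.mem_inter]
  split_ifs at h2 <;> first | omega | tauto

theorem eq_inter_union_inter_compl (A : Finset V) {X : Finset V} : A = A ∩ X ∪ A ∩ Xᶜ := by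
  rw [← Finset.inter_union_distrib_left, Finset.union_compl, Finset.inter_univ]

/-- Every minor of the matrix of a tree vanishes or is, up to sign, the principal minor on the loop
set of a 2-matching. -/
theorem absMinor_eq_zero_or_exists_twoMatching (hT : T.IsTree) (hM : IsGraphMatrix T M) (k : ℕ) :
    ∀ A B : Finset V, A.card = k → B.card = k → absMinor M A B = 0 ∨
      ∃ μ, IsTwoMatching T μ ∧ μ.card = k ∧
        (∀ v, inc μ v ≤ (if v ∈ A then 1 else 0) + (if v ∈ B then 1 else 0)) ∧
        absMinor M A B = absMinor M (loops μ) (loops μ) := by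
  induction k using Nat.strong_induction_on with
  | _ k ih =>
    intro A B hA hB
    by_cases hAB : A = B
    · subst hAB
      have hl : loops (A.image fun v => s(v, v)) = A := by
        ext v; simp
      refine Or.inr ⟨A.image fun v => s(v, v), ⟨?_, fun v => ?_⟩, ?_, fun v => ?_, by rw [hl]⟩
      · intro e he
        obtain ⟨v, -, rfl⟩ := Finset.mem_image.1 he
        exact Or.inr (by simp)
      · change inc _ v ≤ 2
        rw [inc_loopSet]; split_ifs <;> omega
      · rw [Finset.card_image_of_injective _ fun a b hab => by simpa [Sym2.eq_iff] using hab, hA]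
      · rw [inc_loopSet]; split_ifs <;> omega
    obtain ⟨x, y, X, hX, hpos⟩ : ∃ x y X, IsSide T x y X ∧ (B ∩ X).card < (A ∩ X).card := by
      obtain ⟨a, haA, haB⟩ : ∃ a ∈ A, a ∉ B := Finset.not_subset.1 fun hs =>
        hAB (Finset.eq_of_subset_of_card_le hs (by omega))
      have hsum : ∀ X C : Finset V, ∑ v ∈ X, (if v ∈ C then (1 : ℤ) else 0) = (C ∩ X).card := by
        intro X C
        rw [Finset.sum_boole, Finset.inter_comm, Finset.filter_mem_eq_inter]
      obtain ⟨x, y, X, hX, h⟩ := exists_side_sum_pos hT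
        (φ := fun v => (if v ∈ A then (1 : ℤ) else 0) - (if v ∈ B then (1 : ℤ) else 0)) (a := a)
        (by rw [Finset.sum_sub_distrib, hsum, hsum]; simp [hA, hB]) (by simp [haA, haB])
      rw [Finset.sum_sub_distrib, hsum, hsum] at h
      exact ⟨x, y, X, hX, by omega⟩
    have cA := card_inter_add_card_inter_compl A X
    have cB := card_inter_add_card_inter_compl B X
    have hz : ∀ R ⊆ A ∩ X, (B ∩ X).card < R.card → (∀ r ∈ R, ∀ c ∈ B ∩ Xᶜ, r ≠ x ∨ c ≠ y) →
        absMinor M A B = 0 := by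
      intro R hR hc h0
      refine absMinor_eq_zero_of_zero_block M (hR.trans Finset.inter_subset_left)
        (C := B ∩ Xᶜ) Finset.inter_subset_left (fun r hr c hc => ?_) (by omega)
      exact hX.apply_eq_zero hM (Finset.mem_inter.1 (hR hr)).2
        (by simpa using (Finset.mem_inter.1 hc).2) (h0 r hr c hc)
    -- An excess of two or more leaves a zero block even without row `x`. If `y` is not a column, or
    -- `x` is not a row, there is no exceptional entry. In the remaining case the excess is exactly
    -- one.
    by_cases hsmall : (B ∩ X).card < ((A ∩ X).erase x).card
    · exact Or.inl (hz _ (Finset.erase_subset _ _) hsmall fun r hr _ _ =>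
        Or.inl (Finset.ne_of_mem_erase hr))
    by_cases hyB : y ∈ B
    swap
    · refine Or.inl (hz _ subset_rfl hpos fun r _ c hc => Or.inr ?_)
      rintro rfl
      exact hyB (Finset.mem_inter.1 hc).1
    have hxA : x ∈ A ∩ X := by
      by_contra hxA
      rw [Finset.erase_eq_of_notMem hxA] at hsmall
      exact hsmall hpos
    have hyB' : y ∈ B ∩ Xᶜ := by simp [hyB, hX.notMem]
    have e1 := Finset.card_erase_add_one hxA
    have e2 := Finset.card_erase_add_one hyB'
    have dA : A = insert x ((A ∩ X).erase x ∪ A ∩ Xᶜ) := by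
      rw [← Finset.insert_union, Finset.insert_erase hxA]
      exact eq_inter_union_inter_compl A
    have dB : B = insert y (B ∩ X ∪ (B ∩ Xᶜ).erase y) := by
      rw [← Finset.union_insert, Finset.insert_erase hyB']
      exact eq_inter_union_inter_compl B
    have hsplit := hX.absMinor_insert hM (A₁ := (A ∩ X).erase x) (A₂ := A ∩ Xᶜ) (B₁ := B ∩ X)
      (B₂ := (B ∩ Xᶜ).erase y) ((Finset.erase_subset _ _).trans Finset.inter_subset_right)
      Finset.inter_subset_right Finset.inter_subset_right
      ((Finset.erase_subset _ _).trans Finset.inter_subset_right) (by simp) (by simp) (by omega)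
      (by omega)
    rw [← dA, ← dB] at hsplit
    rw [hsplit]
    rcases ih _ (by omega : (B ∩ X).card < k) ((A ∩ X).erase x) (B ∩ X) (by omega) rfl with
      h | ⟨μ₁, hμ₁, hc₁, hi₁, hm₁⟩
    · exact Or.inl (by rw [h, zero_mul])
    rcases ih _ (by omega : (A ∩ Xᶜ).card < k) (A ∩ Xᶜ) ((B ∩ Xᶜ).erase y) rfl (by omega) with
      h | ⟨μ₂, hμ₂, hc₂, hi₂, hm₂⟩
    · exact Or.inl (by rw [h, mul_zero])
    right
    have hz₁ : ∀ v ∉ X, inc μ₁ v = 0 := fun v hv => by simpa [hv] using hi₁ v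
    have hz₂ : ∀ v ∈ X, inc μ₂ v = 0 := fun v hv => by simpa [hv] using hi₂ v
    obtain ⟨jc, ji, jl⟩ := hX.join hz₁ hz₂
    -- Carrying this bound through the induction ensures that adding the edge `xy` keeps the
    -- 2-matching condition: `x` was removed from the rows on its side, `y` from the columns on the
    -- other.
    have hinc : ∀ v, inc (insert s(x, y) (μ₁ ∪ μ₂)) v ≤
        (if v ∈ A then 1 else 0) + (if v ∈ B then 1 else 0) := by
      intro v
      rw [ji]
      have i1 := hi₁ v
      have i2 := hi₂ v
      have hxX := hX.mem
      have hyX := hX.notMem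
      have hxA' := (Finset.mem_inter.1 hxA).1
      by_cases hv : v ∈ X
      · rw [hz₂ v hv]
        have hvy : v ≠ y := fun h => hyX (h ▸ hv)
        by_cases hvx : v = x
        · subst hvx
          simp [hv, hxA', hvy] at i1 ⊢
          omega
        · simpa [hv, hvx, hvy] using i1
      · rw [hz₁ v hv]
        have hvx : v ≠ x := fun h => hv (h ▸ hxX)
        by_cases hvy : v = y
        · subst hvy
          simp [hv, hyB, hvx] at i2 ⊢
          omega
        · simpa [hv, hvx, hvy] using i2
    refine ⟨insert s(x, y) (μ₁ ∪ μ₂), ⟨fun e he => ?_, fun v => ?_⟩, by omega, hinc, ?_⟩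
    · rw [Finset.mem_insert, Finset.mem_union] at he
      rcases he with rfl | he | he
      · exact Or.inl hX.adj
      · exact hμ₁.1 e he
      · exact hμ₂.1 e he
    · refine (hinc v).trans ?_
      split_ifs <;> omega
    · have s1 := loops_subset_of_inc hi₁
      have s2 := loops_subset_of_inc hi₂
      rw [jl, hm₁, hm₂, hX.absMinor_union_self hM]
      · exact s1.trans (Finset.inter_subset_right.trans Finset.inter_subset_right)
      · exact s2.trans (Finset.inter_subset_left.trans Finset.inter_subset_right)
      · left
        intro hx
        simpa using s1 hx

/-- The principal minor on the loop set of a 2-matching of size `k` is, up to sign, a minor of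
order `k`. -/
theorem exists_absMinor_eq_of_twoMatching (hT : T.IsTree) (hM : IsGraphMatrix T M) (k : ℕ) :
    ∀ μ, IsTwoMatching T μ → μ.card = k → ∃ A B : Finset V, A.card = k ∧ B.card = k ∧
      (∀ v, inc μ v = (if v ∈ A then 1 else 0) + (if v ∈ B then 1 else 0)) ∧
      absMinor M A B = absMinor M (loops μ) (loops μ) := by
  induction k using Nat.strong_induction_on with
  | _ k ih =>
    intro μ hμ hk
    by_cases hloop : ∀ e ∈ μ, e.IsDiag
    · have himg : μ = (loops μ).image fun v => s(v, v) := by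
        ext e
        induction e with
        | _ a b =>
          simp only [Finset.mem_image, mem_loops]
          constructor
          · intro h
            obtain rfl : a = b := Sym2.mk_isDiag_iff.1 (hloop _ h)
            exact ⟨a, h, rfl⟩
          · rintro ⟨v, hv, h⟩
            rwa [← h]
      have hc : (loops μ).card = k := by
        rw [← hk]
        conv_rhs => rw [himg]
        rw [Finset.card_image_of_injective _ fun a b hab => by simpa [Sym2.eq_iff] using hab]
      refine ⟨loops μ, loops μ, hc, hc, fun v => ?_, rfl⟩
      conv_lhs => rw [himg]
      rw [inc_loopSet]
      split_ifs <;> rfl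
    push Not at hloop
    obtain ⟨e, he, hd⟩ := hloop
    induction e with
    | _ x y =>
    have hxy : T.Adj x y := (hμ.1 _ he).resolve_right hd
    obtain ⟨X, hX⟩ := exists_isSide hT hxy
    have hcard := hX.card_eq hμ
    rw [if_pos he] at hcard
    have hz₁ : ∀ v ∉ X, inc (restrict μ X) v = 0 := fun v hv => inc_restrict_of_notMem μ hv
    have hz₂ : ∀ v ∈ X, inc (restrict μ Xᶜ) v = 0 := fun v hv =>
      inc_restrict_of_notMem μ (by simpa using hv)
    obtain ⟨jc, ji, jl⟩ := hX.join hz₁ hz₂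
    have hdecomp : insert s(x, y) (restrict μ X ∪ restrict μ Xᶜ) = μ := by
      change insert s(x, y) (splice μ μ X) = μ
      rw [← hX.erase_eq_splice hμ, Finset.insert_erase he]
    rw [hdecomp] at ji jl
    -- The edge `xy` uses one incidence at `x`, so `x` lies in at most one of the two index sets on
    -- its side; by symmetry of `M` these may be swapped so that `x` is not a row. The same is done
    -- for `y` and the columns.
    obtain ⟨A₁, B₁, cA₁, cB₁, hi₁, hm₁, hxA₁⟩ : ∃ A B : Finset V, A.card = (restrict μ X).card ∧
        B.card = (restrict μ X).card ∧
        (∀ v, inc (restrict μ X) v = (if v ∈ A then 1 else 0) + (if v ∈ B then 1 else 0)) ∧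
        absMinor M A B = absMinor M (loops (restrict μ X)) (loops (restrict μ X)) ∧ x ∉ A := by
      obtain ⟨A, B, cA, cB, hi, hm⟩ := ih _ (by omega : (restrict μ X).card < k) _
        (hμ.mono (restrict_subset _ _)) rfl
      by_cases hxA : x ∈ A
      · refine ⟨B, A, cB, cA, fun v => by rw [hi, add_comm], ?_, ?_⟩
        · rw [← hm, ← absMinor_transpose M, hM.transpose]
        · intro hxB
          have h1 := hX.inc_restrict_le hμ he
          rw [hi, if_pos hxA, if_pos hxB] at h1
          omega
      · exact ⟨A, B, cA, cB, hi, hm, hxA⟩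
    obtain ⟨A₂, B₂, cA₂, cB₂, hi₂, hm₂, hyB₂⟩ : ∃ A B : Finset V, A.card = (restrict μ Xᶜ).card ∧
        B.card = (restrict μ Xᶜ).card ∧
        (∀ v, inc (restrict μ Xᶜ) v = (if v ∈ A then 1 else 0) + (if v ∈ B then 1 else 0)) ∧
        absMinor M A B = absMinor M (loops (restrict μ Xᶜ)) (loops (restrict μ Xᶜ)) ∧ y ∉ B := by
      obtain ⟨A, B, cA, cB, hi, hm⟩ := ih _ (by omega : (restrict μ Xᶜ).card < k) _
        (hμ.mono (restrict_subset _ _)) rfl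
      by_cases hyB : y ∈ B
      · refine ⟨B, A, cB, cA, fun v => by rw [hi, add_comm], ?_, ?_⟩
        · rw [← hm, ← absMinor_transpose M, hM.transpose]
        · intro hyA
          have h1 := hX.compl.inc_restrict_le hμ (by rwa [Sym2.eq_swap])
          rw [hi, if_pos hyA, if_pos hyB] at h1
          omega
      · exact ⟨A, B, cA, cB, hi, hm, hyB⟩
    have hsub₁ : A₁ ⊆ X ∧ B₁ ⊆ X := by
      constructor <;> intro v hv <;> by_contra hvX <;> have := hz₁ v hvX <;> rw [hi₁] at this <;>
        simp [hv] at this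
    have hsub₂ : A₂ ⊆ Xᶜ ∧ B₂ ⊆ Xᶜ := by
      constructor <;> intro v hv <;> rw [Finset.mem_compl] <;> intro hvX <;>
        have := hz₂ v hvX <;> rw [hi₂] at this <;> simp [hv] at this
    have dA : Disjoint A₁ A₂ := Finset.disjoint_of_subset_left hsub₁.1
      (Finset.disjoint_of_subset_right hsub₂.1 disjoint_compl_right)
    have dB : Disjoint B₁ B₂ := Finset.disjoint_of_subset_left hsub₁.2
      (Finset.disjoint_of_subset_right hsub₂.2 disjoint_compl_right)
    have hxA₂ : x ∉ A₂ := fun h => Finset.mem_compl.1 (hsub₂.1 h) hX.mem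
    have hyB₁ : y ∉ B₁ := fun h => hX.notMem (hsub₁.2 h)
    refine ⟨insert x (A₁ ∪ A₂), insert y (B₁ ∪ B₂), ?_, ?_, fun v => ?_, ?_⟩
    · rw [Finset.card_insert_of_notMem (by simp [hxA₁, hxA₂]), Finset.card_union_of_disjoint dA]
      omega
    · rw [Finset.card_insert_of_notMem (by simp [hyB₁, hyB₂]), Finset.card_union_of_disjoint dB]
      omega
    · rw [ji, hi₁, hi₂]
      have q1 : (if v ∈ insert x (A₁ ∪ A₂) then 1 else 0) =
          (if v = x then 1 else 0) + (if v ∈ A₁ then 1 else 0) + (if v ∈ A₂ then 1 else 0) := by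
        have hd := Finset.disjoint_left.1 dA
        have := @hd v
        by_cases v = x <;> by_cases v ∈ A₁ <;> by_cases v ∈ A₂ <;> simp_all
      have q2 : (if v ∈ insert y (B₁ ∪ B₂) then 1 else 0) =
          (if v = y then 1 else 0) + (if v ∈ B₁ then 1 else 0) + (if v ∈ B₂ then 1 else 0) := by
        have hd := Finset.disjoint_left.1 dB
        have := @hd v
        by_cases v = y <;> by_cases v ∈ B₁ <;> by_cases v ∈ B₂ <;> simp_all
      rw [q1, q2]
      omega
    · have s1 := loops_subset_of_inc (fun v => (hi₁ v).le)
      rw [hX.absMinor_insert hM hsub₁.1 hsub₁.2 hsub₂.1 hsub₂.2 hxA₁ hyB₂ (by omega) (by omega),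
        jl, hm₁, hm₂, hX.absMinor_union_self hM]
      · rw [loops_restrict]; exact Finset.inter_subset_right
      · rw [loops_restrict]; exact Finset.inter_subset_right
      · exact Or.inl fun hx => hxA₁ (Finset.mem_inter.1 (s1 hx)).1

/-- Expansion of a principal minor at the vertex `w`, in divisibility form. -/
theorem dvd_absMinor_self_of_erase (hT : T.IsTree) (hM : IsGraphMatrix T M) {S : Finset V} {w : V}
    (hw : w ∈ S) {d : ℤ} (h1 : d ∣ absMinor M (S.erase w) (S.erase w))
    (h2 : ∀ w' ∈ S, T.Adj w w' →
      d ∣ absMinor M ((S.erase w).erase w') ((S.erase w).erase w')) :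
    d ∣ absMinor M S S := by
  refine dvd_absMinor_of_forall_erase M hw fun b hb hne => ?_
  by_cases hbw : b = w
  · rw [hbw]; exact h1
  have hadj : T.Adj w b := by
    by_contra h
    exact hne (hM.not_adj w b (Ne.symm hbw) h)
  obtain ⟨X, hX⟩ := exists_isSide hT hadj.symm
  have hbX := hX.mem
  have hwX := hX.notMem
  have e1 : S.erase w = insert b (S.erase b ∩ X ∪ S.erase w ∩ Xᶜ) := by
    ext v
    grind [Finset.mem_compl]
  have e2 : S.erase b = insert w (S.erase b ∩ X ∪ S.erase w ∩ Xᶜ) := by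
    ext v
    grind [Finset.mem_compl]
  have e3 : (S.erase w).erase b = S.erase b ∩ X ∪ S.erase w ∩ Xᶜ := by
    ext v
    grind [Finset.mem_compl]
  -- The rows `S.erase w` and columns `S.erase b` differ only by `b` against `w`. The edge `bw`
  -- splits this minor into the same two principal minors as the set with both vertices removed.
  have key : absMinor M (S.erase w) (S.erase b) =
      absMinor M ((S.erase w).erase b) ((S.erase w).erase b) := by
    rw [e3, hX.absMinor_union_self hM Finset.inter_subset_right Finset.inter_subset_right
      (Or.inl (by simp)), ← hX.absMinor_insert hM Finset.inter_subset_right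
      Finset.inter_subset_right Finset.inter_subset_right Finset.inter_subset_right (by simp)
      (by simp) rfl rfl, ← e1, ← e2]
  rw [key]
  exact h2 b hb hadj

/-- An integer dividing the principal minors on the loop sets of all minimal 2-matchings of size
`k` divides the principal minors on the loop sets of all 2-matchings with at least `k` edges. -/
theorem dvd_absMinor_of_isLoopSet (hT : T.IsTree) (hM : IsGraphMatrix T M) {k : ℕ} {d : ℤ}
    (h : ∀ μ, IsMinimalTwoMatching T μ → μ.card = k → d ∣ absMinor M (loops μ) (loops μ))
    (S : Finset V) : IsLoopSet T k S → d ∣ absMinor M S S := by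
  induction S using Finset.strongInduction with
  | _ S ih =>
    intro hS
    by_cases hmin : ∃ w ∈ S, IsLoopSet T k (S.erase w)
    · obtain ⟨w, hw, hSw⟩ := hmin
      refine dvd_absMinor_self_of_erase hT hM hw (ih _ (Finset.erase_ssubset hw) hSw)
        fun w' hw' hadj => ih _ ?_ (hS.erase_erase hT hw hSw hw' hadj)
      exact (Finset.erase_subset _ _).trans_ssubset (Finset.erase_ssubset hw)
    · have hmin' : ∀ S' ⊂ S, ¬ IsLoopSet T k S' := by
        intro S' hS' hl
        have hpos : 0 < (S \ S').card := Finset.card_pos.2 (Finset.sdiff_nonempty.2 hS'.2)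
        exact hmin (exists_isLoopSet_erase hT hS ((S \ S').card - 1) S' hS' hl (by omega))
      -- Loop sets allow more than `k` edges; trimming to exactly `k` cannot lose a loop, as that
      -- would contradict minimality of `S`.
      obtain ⟨μ, hμ, hl, hc⟩ : ∃ μ, IsTwoMatching T μ ∧ loops μ = S ∧ μ.card = k := by
        obtain ⟨μ, hμ, hl, hk⟩ := hS
        obtain ⟨ν, hν, hνk⟩ := Finset.exists_subset_card_eq hk
        refine ⟨ν, hμ.mono hν, ?_, hνk⟩
        have hsub : loops ν ⊆ S := by
          rw [← hl]
          intro v hv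
          exact mem_loops.2 (hν (mem_loops.1 hv))
        by_contra hne
        exact hmin' _ (hsub.ssubset_of_ne hne) ⟨ν, hμ.mono hν, rfl, hνk.ge⟩
      rw [← hl]
      refine h μ ⟨hμ, fun ν hν hνc hss => ?_⟩ hc
      rw [hl] at hss
      exact hmin' _ hss ⟨ν, hν, rfl, (hνc.trans hc).ge⟩

/-- The minors of order `k` of the matrix of a tree and its principal minors on the loop sets of
minimal 2-matchings of size `k` have the same common divisors. -/
theorem forall_dvd_minor_iff (hT : T.IsTree) (hM : IsGraphMatrix T M) (k : ℕ) (d : ℤ) :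
    (∀ f g : Fin k → V, d ∣ (M.submatrix f g).det) ↔
      d ∣ (minTwoMatchings T k).gcd fun μ => principalMinor M (loops μ) := by
  rw [forall_dvd_det_submatrix_iff, Finset.dvd_gcd_iff]
  simp only [minTwoMatchings, Finset.mem_filter, Finset.mem_univ, true_and]
  constructor
  · rintro h μ ⟨hμ, hk⟩
    obtain ⟨A, B, hA, hB, -, hm⟩ := exists_absMinor_eq_of_twoMatching hT hM k μ hμ.1 hk
    rw [← dvd_abs, ← absMinor_self, ← hm]
    exact h A B hA hB
  · intro h A B hA hB
    rcases absMinor_eq_zero_or_exists_twoMatching hT hM k A B hA hB with h0 | ⟨μ, hμ, hc, -, hm⟩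
    · rw [h0]; exact dvd_zero d
    · rw [hm]
      refine dvd_absMinor_of_isLoopSet hT hM (fun ν hν hk => ?_) _ ⟨μ, hμ, rfl, hc.ge⟩
      rw [absMinor_self, dvd_abs]
      exact h ν ⟨hν, hk⟩

end TreeMinors

/-! ### Existence of the Smith normal form over the integers -/

section SmithNormalForm

/-- Equivalence of integer matrices. -/
def MatEquiv {m : Type*} [Fintype m] [DecidableEq m] (M N : Matrix m m ℤ) : Prop :=
  ∃ P Q : GL m ℤ, (P : Matrix m m ℤ) * M * (Q : Matrix m m ℤ) = N

variable {m : Type*} [Fintype m] [DecidableEq m] {M N : Matrix m m ℤ}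

theorem MatEquiv.refl (M : Matrix m m ℤ) : MatEquiv M M := ⟨1, 1, by simp⟩

theorem MatEquiv.trans {K : Matrix m m ℤ} (h : MatEquiv M N) (h' : MatEquiv N K) :
    MatEquiv M K := by
  obtain ⟨P, Q, rfl⟩ := h
  obtain ⟨P', Q', rfl⟩ := h'
  exact ⟨P' * P, Q * Q', by simp [Matrix.mul_assoc]⟩

theorem MatEquiv.transpose (h : MatEquiv M N) : MatEquiv Mᵀ Nᵀ := by
  obtain ⟨P, Q, rfl⟩ := h
  have key : ∀ R : GL m ℤ, ∃ R' : GL m ℤ, (R' : Matrix m m ℤ) = (R : Matrix m m ℤ)ᵀ := fun R =>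
    ⟨⟨(R : Matrix m m ℤ)ᵀ, ((R⁻¹ : GL m ℤ) : Matrix m m ℤ)ᵀ,
      by rw [← transpose_mul, ← Units.val_mul]; simp,
      by rw [← transpose_mul, ← Units.val_mul]; simp⟩, rfl⟩
  obtain ⟨P', hP⟩ := key P
  obtain ⟨Q', hQ⟩ := key Q
  exact ⟨Q', P', by rw [hP, hQ, transpose_mul, transpose_mul, Matrix.mul_assoc]⟩

theorem MatEquiv.permute_rows (M : Matrix m m ℤ) (σ : Equiv.Perm m) :
    MatEquiv M (M.submatrix σ id) := by
  have h : ∀ (τ : Equiv.Perm m) (K : Matrix m m ℤ),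
      (1 : Matrix m m ℤ).submatrix τ (Equiv.refl m) * K = K.submatrix τ id := fun τ K => by
    rw [one_submatrix_mul]; rfl
  refine ⟨⟨(1 : Matrix m m ℤ).submatrix σ (Equiv.refl m),
    (1 : Matrix m m ℤ).submatrix σ.symm (Equiv.refl m), ?_, ?_⟩, 1, ?_⟩
  · rw [h, submatrix_submatrix]; ext; simp [Matrix.one_apply]
  · rw [h, submatrix_submatrix]; ext; simp [Matrix.one_apply]
  · rw [Units.val_one, mul_one]; exact h σ M

/-- Adding multiples of the row `j` to the other rows. -/
theorem MatEquiv.add_rows (M : Matrix m m ℤ) (j : m) (u : m → ℤ) (hu : u j = 0) :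
    MatEquiv M (Matrix.of fun i k => M i k + u i * M j k) := by
  -- Since `u j = 0`, this rank-one matrix squares to zero, so adding it to and subtracting it from
  -- the identity gives mutually inverse matrices.
  have h1 : vecMulVec u (Pi.single j 1) * vecMulVec u (Pi.single j 1) = 0 := by
    ext a b
    simp [vecMulVec_mul_vecMulVec, hu]
  refine ⟨⟨1 + vecMulVec u (Pi.single j 1), 1 - vecMulVec u (Pi.single j 1), ?_, ?_⟩, 1, ?_⟩
  · rw [add_mul, mul_sub, mul_sub, h1]; simp
  · rw [sub_mul, mul_add, mul_add, h1]; simp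
  · rw [Units.val_one, mul_one]
    ext i k
    simp [add_mul, vecMulVec, Matrix.mul_apply, Pi.single_apply, Matrix.one_apply,
      Finset.sum_add_distrib]

/-- `a` is a nonzero integer of least absolute value among the entries of the matrices equivalent
to `M`. -/
def IsMinEntry (M : Matrix m m ℤ) (a : ℤ) : Prop :=
  a ≠ 0 ∧ ∀ N, MatEquiv M N → ∀ i j, N i j ≠ 0 → a.natAbs ≤ (N i j).natAbs

theorem IsMinEntry.transpose {a : ℤ} (h : IsMinEntry M a) : IsMinEntry Mᵀ a :=
  ⟨h.1, fun N hN i j hij => h.2 Nᵀ (by simpa using hN.transpose) j i hij⟩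

theorem exists_isMinEntry (hM : M ≠ 0) : ∃ N i j, MatEquiv M N ∧ IsMinEntry M (N i j) := by
  classical
  have hex : ∃ k : ℕ, ∃ N i j, MatEquiv M N ∧ N i j ≠ 0 ∧ (N i j).natAbs = k := by
    by_contra! h
    refine hM (Matrix.ext fun i j => ?_)
    by_contra hij
    exact h _ M i j (MatEquiv.refl M) hij rfl
  obtain ⟨N, i, j, hN, hne, hk⟩ := Nat.find_spec hex
  refine ⟨N, i, j, hN, hne, fun N' hN' i' j' h' => ?_⟩
  rw [hk]
  exact Nat.find_min' hex ⟨N', i', j', hN', h', rfl⟩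

/-- A nonzero remainder modulo the pivot would be a smaller entry of an equivalent matrix. -/
theorem IsMinEntry.dvd_col {i₀ j₀ : m} (h : IsMinEntry M (N i₀ j₀)) (hN : MatEquiv M N) (i : m) :
    N i₀ j₀ ∣ N i j₀ := by
  by_cases hi : i = i₀
  · rw [hi]
  by_contra hd
  have hN' := hN.trans (MatEquiv.add_rows N i₀ (Pi.single i (-(N i j₀ / N i₀ j₀)))
    (by simp [Ne.symm hi]))
  have hval : (Matrix.of fun a b => N a b + Pi.single (M := fun _ => ℤ) i (-(N i j₀ / N i₀ j₀)) a *
      N i₀ b) i j₀ = N i j₀ % N i₀ j₀ := by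
    simp [Int.emod_def, sub_eq_add_neg, mul_comm]
  have hne : N i j₀ % N i₀ j₀ ≠ 0 := fun h0 => hd (Int.dvd_of_emod_eq_zero h0)
  have h1 := h.2 _ hN' i j₀ (by rw [hval]; exact hne)
  rw [hval] at h1
  have h2 := Int.emod_lt_abs (N i j₀) h.1
  rw [Int.abs_eq_natAbs] at h2
  have h3 := Int.emod_nonneg (N i j₀) h.1
  omega

theorem IsMinEntry.dvd_row {i₀ j₀ : m} (h : IsMinEntry M (N i₀ j₀)) (hN : MatEquiv M N) (j : m) :
    N i₀ j₀ ∣ N i₀ j :=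
  IsMinEntry.dvd_col (M := Mᵀ) (N := Nᵀ) (i₀ := j₀) (j₀ := i₀) h.transpose hN.transpose j

theorem exists_clear_col {i₀ j₀ : m} (h : IsMinEntry M (N i₀ j₀)) (hN : MatEquiv M N) :
    ∃ N', MatEquiv M N' ∧ (∀ j, N' i₀ j = N i₀ j) ∧ (∀ i, i ≠ i₀ → N' i j₀ = 0) ∧
      ∀ i j, N i₀ j = 0 → N' i j = N i j := by
  have hd := fun i => h.dvd_col hN i
  refine ⟨_, hN.trans (MatEquiv.add_rows N i₀ (fun i => if i = i₀ then 0 else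
    -(N i j₀ / N i₀ j₀)) (by simp)), fun j => by simp, fun i hi => ?_, fun i j hij => by simp [hij]⟩
  simp [hi, Int.ediv_mul_cancel (hd i)]

/-- Clearing the row is clearing a column of the transpose; this leaves the pivot row of the
transpose, the column already cleared, unchanged. -/
theorem exists_clear {i₀ j₀ : m} (h : IsMinEntry M (N i₀ j₀)) (hN : MatEquiv M N) :
    ∃ N', MatEquiv M N' ∧ N' i₀ j₀ = N i₀ j₀ ∧ (∀ i, i ≠ i₀ → N' i j₀ = 0) ∧
      ∀ j, j ≠ j₀ → N' i₀ j = 0 := by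
  obtain ⟨N₁, hN₁, hr₁, hc₁, -⟩ := exists_clear_col h hN
  have h₁ : IsMinEntry M (N₁ i₀ j₀) := by rw [hr₁]; exact h
  obtain ⟨N₂, hN₂, hr₂, hc₂, hz₂⟩ := exists_clear_col (M := Mᵀ) (N := N₁ᵀ) (i₀ := j₀) (j₀ := i₀)
    h₁.transpose hN₁.transpose
  refine ⟨N₂ᵀ, by simpa using hN₂.transpose, ?_, fun i hi => ?_, fun j hj => hc₂ j hj⟩
  · rw [transpose_apply, hr₂, transpose_apply, hr₁]
  · rw [transpose_apply, hr₂, transpose_apply, hc₁ i hi]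

/-- Adding row `i` to the pivot row keeps the pivot and brings the entry at `(i, j)` into its row,
where divisibility is known. -/
theorem IsMinEntry.dvd_of_clear {i₀ j₀ : m} (h : IsMinEntry M (N i₀ j₀)) (hN : MatEquiv M N)
    (hc : ∀ i, i ≠ i₀ → N i j₀ = 0) (hr : ∀ j, j ≠ j₀ → N i₀ j = 0) (i j : m) :
    N i₀ j₀ ∣ N i j := by
  by_cases hi : i = i₀
  · rw [hi]; exact h.dvd_row hN j
  by_cases hj : j = j₀
  · rw [hj]; exact h.dvd_col hN i
  have hN' := hN.trans (MatEquiv.add_rows N i (Pi.single i₀ 1) (by simp [hi]))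
  set N' : Matrix m m ℤ := Matrix.of fun a b => N a b + Pi.single (M := fun _ => ℤ) i₀ 1 a * N i b
    with hN'd
  have h0 : N' i₀ j₀ = N i₀ j₀ := by simp [hN'd, hc i hi]
  have h1 : N' i₀ j = N i j := by simp [hN'd, hr j hj]
  rw [← h1, ← h0]
  exact IsMinEntry.dvd_row (by rw [h0]; exact h) hN' j

/-- The block diagonal matrix with blocks `a` and `A`. -/
def consBlock {n : ℕ} (a : ℤ) (A : Matrix (Fin n) (Fin n) ℤ) :
    Matrix (Fin (n + 1)) (Fin (n + 1)) ℤ :=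
  Matrix.of (Fin.cons (Fin.cons a 0) fun i => Fin.cons 0 (A i))

theorem consBlock_mul {n : ℕ} (a b : ℤ) (A B : Matrix (Fin n) (Fin n) ℤ) :
    consBlock a A * consBlock b B = consBlock (a * b) (A * B) := by
  ext i j
  refine Fin.cases ?_ (fun i => ?_) i <;> refine Fin.cases ?_ (fun j => ?_) j <;>
    simp [consBlock, Matrix.mul_apply, Fin.sum_univ_succ]

theorem consBlock_one {n : ℕ} : consBlock 1 (1 : Matrix (Fin n) (Fin n) ℤ) = 1 := by
  ext i j
  refine Fin.cases ?_ (fun i => ?_) i <;> refine Fin.cases ?_ (fun j => ?_) j <;>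
    simp [consBlock, Matrix.one_apply, Fin.succ_ne_zero, (Fin.succ_ne_zero _).symm]

theorem MatEquiv.consBlock {n : ℕ} (a : ℤ) {A B : Matrix (Fin n) (Fin n) ℤ} (h : MatEquiv A B) :
    MatEquiv (consBlock a A) (consBlock a B) := by
  have key : ∀ R : GL (Fin n) ℤ, ∃ R' : GL (Fin (n + 1)) ℤ,
      (R' : Matrix (Fin (n + 1)) (Fin (n + 1)) ℤ) = TreeSNF.consBlock 1 (R : Matrix _ _ ℤ) :=
    fun R => ⟨⟨TreeSNF.consBlock 1 (R : Matrix _ _ ℤ),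
      TreeSNF.consBlock 1 ((R⁻¹ : GL (Fin n) ℤ) : Matrix _ _ ℤ),
      by rw [consBlock_mul, ← Units.val_mul]; simp [consBlock_one],
      by rw [consBlock_mul, ← Units.val_mul]; simp [consBlock_one]⟩, rfl⟩
  obtain ⟨P, Q, rfl⟩ := h
  obtain ⟨P', hP⟩ := key P
  obtain ⟨Q', hQ⟩ := key Q
  exact ⟨P', Q', by rw [hP, hQ, consBlock_mul, consBlock_mul]; simp⟩

theorem MatEquiv.dvd_apply {a : ℤ} (h : MatEquiv M N) (ha : ∀ i j, a ∣ M i j) (i j : m) :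
    a ∣ N i j := by
  obtain ⟨P, Q, rfl⟩ := h
  rw [Matrix.mul_apply]
  refine Finset.dvd_sum fun k _ => Dvd.dvd.mul_right ?_ _
  rw [Matrix.mul_apply]
  exact Finset.dvd_sum fun l _ => (ha l k).mul_left _

theorem exists_matEquiv_diagonal_dvd (n : ℕ) : ∀ M : Matrix (Fin n) (Fin n) ℤ,
    ∃ d : Fin n → ℤ, MatEquiv M (diagonal d) ∧ ∀ i j, i ≤ j → d i ∣ d j := by
  induction n with
  | zero => exact fun M => ⟨0, by rw [Subsingleton.elim (diagonal 0) M]; exact MatEquiv.refl M,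
      fun i => i.elim0⟩
  | succ n ih =>
    intro M
    by_cases hM : M = 0
    · exact ⟨fun _ => 0, by rw [hM, diagonal_zero]; exact MatEquiv.refl 0, fun _ _ _ => dvd_rfl⟩
    obtain ⟨N, i, j, hN, hmin⟩ := exists_isMinEntry hM
    have hN₁ := hN.trans (MatEquiv.permute_rows N (Equiv.swap 0 i))
    have hN₂ := hN₁.trans (by
      simpa using (MatEquiv.permute_rows (N.submatrix (Equiv.swap 0 i) id)ᵀ
        (Equiv.swap 0 j)).transpose)
    set N₂ := N.submatrix (Equiv.swap 0 i) (Equiv.swap 0 j) with hN₂d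
    have h0 : N₂ 0 0 = N i j := by simp [hN₂d]
    have hmin₂ : IsMinEntry M (N₂ 0 0) := by rw [h0]; exact hmin
    obtain ⟨K, hK, hK0, hc, hr⟩ := exists_clear hmin₂ hN₂
    have hminK : IsMinEntry M (K 0 0) := by rw [hK0]; exact hmin₂
    have hdvd := hminK.dvd_of_clear hK hc hr
    have hKb : K = consBlock (K 0 0) (K.submatrix Fin.succ Fin.succ) := by
      ext a b
      refine Fin.cases ?_ (fun a => ?_) a <;> refine Fin.cases ?_ (fun b => ?_) b
      · simp [TreeSNF.consBlock]
      · simp [TreeSNF.consBlock, hr _ (Fin.succ_ne_zero b)]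
      · simp [TreeSNF.consBlock, hc _ (Fin.succ_ne_zero a)]
      · simp [TreeSNF.consBlock]
    obtain ⟨d, hd, hdd⟩ := ih (K.submatrix Fin.succ Fin.succ)
    have had : ∀ i, K 0 0 ∣ d i := fun i => by
      simpa using hd.dvd_apply (fun a b => hdvd a.succ b.succ) i i
    refine ⟨Fin.cons (K 0 0) d, ?_, ?_⟩
    · have : diagonal (Fin.cons (K 0 0) d) = TreeSNF.consBlock (K 0 0) (diagonal d) := by
        ext a b
        refine Fin.cases ?_ (fun a => ?_) a <;> refine Fin.cases ?_ (fun b => ?_) b <;>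
          simp [TreeSNF.consBlock, diagonal_apply, Fin.succ_ne_zero, (Fin.succ_ne_zero _).symm]
      rw [this]
      refine hK.trans ?_
      conv => lhs; rw [hKb]
      exact hd.consBlock _
    · intro a b
      refine Fin.cases ?_ (fun a => ?_) a <;> refine Fin.cases ?_ (fun b => ?_) b
      · simp
      · intro _; simpa using had b
      · intro h; simp at h
      · intro h; simpa using hdd a b (by simpa using h)

/-- Existence of the Smith normal form of a square integer matrix. -/
theorem exists_smithNormalForm {n : ℕ} (M : Matrix (Fin n) (Fin n) ℤ) :
    ∃ d : Fin n → ℤ, MatEquiv M (diagonal d) ∧ (∀ i, 0 ≤ d i) ∧ ∀ i j, i ≤ j → d i ∣ d j := by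
  obtain ⟨d, hd, hdd⟩ := exists_matEquiv_diagonal_dvd n M
  refine ⟨fun i => |d i|, hd.trans ?_, fun i => abs_nonneg _, fun i j hij => by
    simpa using hdd i j hij⟩
  have hs : ∀ i, (if d i < 0 then (-1 : ℤ) else 1) * (if d i < 0 then (-1 : ℤ) else 1) = 1 :=
    fun i => by split_ifs <;> norm_num
  refine ⟨⟨diagonal fun i => if d i < 0 then -1 else 1, diagonal fun i => if d i < 0 then -1 else 1,
    ?_, ?_⟩, 1, ?_⟩
  · simp [diagonal_mul_diagonal, hs]
  · simp [diagonal_mul_diagonal, hs]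
  · rw [Units.val_one, mul_one, diagonal_mul_diagonal]
    congr 1
    ext i
    split_ifs with h
    · rw [abs_of_neg h]; ring
    · rw [abs_of_nonneg (not_lt.1 h)]; ring

end SmithNormalForm

/-! ### Invariance of determinantal divisors -/

section DeterminantalDivisors

variable {m V W : Type*} [Fintype m] [DecidableEq m]

/-- Common divisors of the minors of order `k` are not lost by multiplication on the left. -/
theorem dvd_minor_mul_left {z : ℤ} {k : ℕ} (P : Matrix V m ℤ) (M : Matrix m W ℤ)
    (h : ∀ (f : Fin k → m) (g : Fin k → W), z ∣ (M.submatrix f g).det) (f : Fin k → V)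
    (g : Fin k → W) : z ∣ ((P * M).submatrix f g).det := by
  -- The rows of the product are integer combinations of rows of `M`, so multilinearity writes its
  -- minors as integer combinations of minors of `M`.
  have h1 : (P * M).submatrix f g =
      Matrix.of fun i => ∑ j : m, P (f i) j • (M.submatrix id g) j := by
    ext i l
    simp [Matrix.mul_apply, Finset.sum_apply]
  have h2 : ((P * M).submatrix f g).det = (detRowAlternating (R := ℤ)).toMultilinearMap
      (fun i => ∑ j : m, P (f i) j • (M.submatrix id g) j) := by
    rw [h1]; rfl
  rw [h2, MultilinearMap.map_sum]
  refine Finset.dvd_sum fun r _ => ?_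
  rw [MultilinearMap.map_smul_univ, smul_eq_mul]
  exact Dvd.dvd.mul_left (h r g) _

theorem dvd_minor_mul_right {z : ℤ} {k : ℕ} (M : Matrix V m ℤ) (Q : Matrix m W ℤ)
    (h : ∀ (f : Fin k → V) (g : Fin k → m), z ∣ (M.submatrix f g).det) (f : Fin k → V)
    (g : Fin k → W) : z ∣ ((M * Q).submatrix f g).det := by
  rw [← det_transpose, transpose_submatrix, transpose_mul]
  refine dvd_minor_mul_left Qᵀ Mᵀ (fun f g => ?_) g f
  rw [← transpose_submatrix, det_transpose]
  exact h g f

theorem MatEquiv.dvd_minor {M N : Matrix m m ℤ} (h : MatEquiv M N) {z : ℤ} {k : ℕ}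
    (hM : ∀ f g : Fin k → m, z ∣ (M.submatrix f g).det) (f g : Fin k → m) :
    z ∣ (N.submatrix f g).det := by
  obtain ⟨P, Q, rfl⟩ := h
  exact dvd_minor_mul_right _ _ (dvd_minor_mul_left _ _ hM) f g

theorem MatEquiv.symm {M N : Matrix m m ℤ} (h : MatEquiv M N) : MatEquiv N M := by
  obtain ⟨P, Q, rfl⟩ := h
  refine ⟨P⁻¹, Q⁻¹, ?_⟩
  rw [Matrix.mul_assoc (P : Matrix m m ℤ), ← Matrix.mul_assoc ((P⁻¹ : GL m ℤ) : Matrix m m ℤ),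
    ← Units.val_mul, inv_mul_cancel, Units.val_one, one_mul, Matrix.mul_assoc, ← Units.val_mul,
    mul_inv_cancel, Units.val_one, mul_one]

/-- Minors with different row and column sets vanish. A principal minor is a multiple of the leading
one, because the element of `A` in position `i` is at least `i`. -/
theorem forall_dvd_minor_diagonal_iff {n k : ℕ} (hk : k ≤ n) {d : Fin n → ℤ}
    (hd : ∀ i j, i ≤ j → d i ∣ d j) (z : ℤ) :
    (∀ f g : Fin k → Fin n, z ∣ ((diagonal d).submatrix f g).det) ↔
      z ∣ ∏ i : Fin k, d (Fin.castLE hk i) := by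
  have hdet : ∀ f : Fin k → Fin n, Function.Injective f →
      ((diagonal d).submatrix f f).det = ∏ i, d (f i) := fun f hf => by
    rw [submatrix_diagonal _ _ hf, det_diagonal]; rfl
  constructor
  · intro h
    rw [← hdet _ (Fin.castLE_injective hk)]
    exact h _ _
  · intro h
    rw [forall_dvd_det_submatrix_iff]
    intro A B hA hB
    by_cases hAB : A = B
    · subst hAB
      rw [← abs_det_submatrix_eq_absMinor' _ (f := A.orderEmbOfFin hA) (g := A.orderEmbOfFin hA)
        (A.orderEmbOfFin hA).injective (A.orderEmbOfFin hA).injective, dvd_abs,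
        hdet _ (A.orderEmbOfFin hA).injective]
      · refine h.trans (Finset.prod_dvd_prod_of_dvd _ _ fun i _ => hd _ _ ?_)
        have hmono : ∀ (a : ℕ) (ha : a < k), a ≤ (A.orderEmbOfFin hA ⟨a, ha⟩ : ℕ) := by
          intro a
          induction a with
          | zero => intro _; exact Nat.zero_le _
          | succ a ih =>
            intro ha
            have h1 := ih (by omega)
            have h2 : A.orderEmbOfFin hA ⟨a, by omega⟩ < A.orderEmbOfFin hA ⟨a + 1, ha⟩ :=
              (A.orderEmbOfFin hA).strictMono (by simp [Fin.lt_def])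
            rw [Fin.lt_def] at h2
            omega
        exact hmono i i.2
      all_goals
        intro v
        rw [← Set.mem_range, Finset.range_orderEmbOfFin, Finset.mem_coe]
    · obtain ⟨a, ha, hb⟩ : ∃ a ∈ A, a ∉ B := Finset.not_subset.1 fun hs =>
        hAB (Finset.eq_of_subset_of_card_le hs (by omega))
      rw [absMinor_eq_zero_of_zero_block _ (R := {a}) (C := B) (by simpa using ha) subset_rfl]
      · exact dvd_zero z
      · intro r hr c hc
        rw [Finset.mem_singleton] at hr
        subst hr
        exact diagonal_apply_ne _ fun h => hb (h ▸ hc)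
      · simp; omega

end DeterminantalDivisors

/-! ### The Cauchy-Binet formula -/

section CauchyBinet

variable {m n : Type*} [Fintype m] [DecidableEq m] [Fintype n] [DecidableEq n]

theorem exists_injective_image_eq {K : Finset n} (hK : K.card = Fintype.card m) :
    ∃ g : m → n, Function.Injective g ∧ Finset.univ.image g = K := by
  obtain ⟨e⟩ : Nonempty (m ≃ K) := Fintype.card_eq.1 (by simp [hK])
  refine ⟨fun i => e i, fun i j hij => by simpa using hij, ?_⟩
  ext v
  simp only [Finset.mem_image, Finset.mem_univ, true_and]
  exact ⟨by rintro ⟨i, rfl⟩; exact (e i).2, fun hv => ⟨e.symm ⟨v, hv⟩, by simp⟩⟩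

/-- The part of the Cauchy-Binet expansion with a fixed set of indices. -/
theorem sum_injective_image_eq (A B : Matrix m n ℤ) {g : m → n} (hg : Function.Injective g) :
    ∑ r ∈ Finset.univ.filter (fun r : m → n => Function.Injective r ∧
        Finset.univ.image r = Finset.univ.image g), (∏ i, A i (r i)) * (Bᵀ.submatrix r id).det =
      (A.submatrix id g).det * (B.submatrix id g).det := by
  have h1 : (A.submatrix id g).det = ∑ σ : Equiv.Perm m, (Equiv.Perm.sign σ : ℤ) *
      ∏ i, A i (g (σ i)) := by
    rw [← det_transpose, det_apply']; rfl
  rw [h1, Finset.sum_mul]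
  symm
  refine Finset.sum_bij (fun σ _ => g ∘ σ) (fun σ _ => ?_) (fun σ _ τ _ h => ?_) (fun r hr => ?_)
    (fun σ _ => ?_)
  · simp only [Finset.mem_filter, Finset.mem_univ, true_and]
    refine ⟨hg.comp σ.injective, ?_⟩
    rw [← Finset.image_image, Finset.image_univ_equiv]
  · ext i
    exact hg (congrFun h i)
  · simp only [Finset.mem_filter, Finset.mem_univ, true_and] at hr
    have hex : ∀ i, ∃ j, g j = r i := fun i => by
      have : r i ∈ Finset.univ.image g := hr.2 ▸ Finset.mem_image_of_mem r (Finset.mem_univ i)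
      simpa using this
    choose σ hσ using hex
    have hσi : Function.Injective σ := fun i j hij => hr.1 (by rw [← hσ, ← hσ, hij])
    exact ⟨Equiv.ofBijective σ (Finite.injective_iff_bijective.1 hσi), Finset.mem_univ _,
      funext hσ⟩
  -- Reordering the rows by `σ` produces exactly the sign occurring in the Leibniz formula for the
  -- other factor.
  · have h2 : Bᵀ.submatrix (g ∘ σ) id = (B.submatrix id g)ᵀ.submatrix σ id := rfl
    rw [h2, det_permute, det_transpose]
    simp only [Function.comp_apply]
    push_cast
    ring

/-- The determinant is expanded by multilinearity over all functions `r : m → n`; those with a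
repeated value vanish, the others are grouped by image. The function `F` records that the product of
minors depends only on the column set, the signs of an enumeration cancelling. -/
theorem det_mul_transpose_eq_sum (A B : Matrix m n ℤ) {F : Finset n → ℤ}
    (hF : ∀ g : m → n, Function.Injective g →
      (A.submatrix id g).det * (B.submatrix id g).det = F (Finset.univ.image g)) :
    (A * Bᵀ).det = ∑ K ∈ Finset.powersetCard (Fintype.card m) Finset.univ, F K := by
  have h1 : (A * Bᵀ).det = (detRowAlternating (R := ℤ)).toMultilinearMap
      (fun i => ∑ j : n, A i j • Bᵀ j) := by
    have : A * Bᵀ = Matrix.of fun i => ∑ j : n, A i j • Bᵀ j := by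
      ext i l
      simp [Matrix.mul_apply, Finset.sum_apply]
    rw [this]; rfl
  rw [h1, MultilinearMap.map_sum]
  have h2 : ∀ r : m → n, (detRowAlternating (R := ℤ)).toMultilinearMap
      (fun i => A i (r i) • Bᵀ (r i)) = (∏ i, A i (r i)) * (Bᵀ.submatrix r id).det := fun r => by
    rw [MultilinearMap.map_smul_univ, smul_eq_mul]; rfl
  simp only [h2]
  rw [← Finset.sum_filter_of_ne (p := Function.Injective)]
  · rw [← Finset.sum_fiberwise_of_maps_to (t := Finset.powersetCard (Fintype.card m) Finset.univ)
      (g := fun r : m → n => Finset.univ.image r)]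
    · refine Finset.sum_congr rfl fun K hK => ?_
      obtain ⟨g, hg, rfl⟩ := exists_injective_image_eq (Finset.mem_powersetCard.1 hK).2
      rw [← hF g hg, ← sum_injective_image_eq A B hg, Finset.filter_filter]
    · intro r hr
      simp only [Finset.mem_filter, Finset.mem_univ, true_and] at hr
      simp [Finset.mem_powersetCard, Finset.card_image_of_injective _ hr]
  · intro r _ hr
    by_contra hinj
    simp only [Function.Injective, not_forall] at hinj
    obtain ⟨i, j, hij, hne⟩ := hinj
    exact hr (by rw [det_zero_of_row_eq hne (by ext; simp [hij]), mul_zero])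

/-- The Cauchy-Binet formula with weighted columns. -/
theorem det_mul_diagonal_mul_transpose (N : Matrix m n ℤ) (w : n → ℤ) :
    (N * (N * diagonal w)ᵀ).det = ∑ K ∈ Finset.powersetCard (Fintype.card m) Finset.univ,
      (∏ k ∈ K, w k) * absMinor N Finset.univ K ^ 2 := by
  refine det_mul_transpose_eq_sum _ _ fun g hg => ?_
  have h1 : (N * diagonal w).submatrix id g = N.submatrix id g * diagonal (w ∘ g) := by
    ext i j; simp [Matrix.mul_diagonal]
  rw [h1, det_mul, det_diagonal, Finset.prod_image (fun i _ j _ hij => hg hij),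
    ← abs_det_submatrix_eq_absMinor' N (f := id) (g := g) Function.injective_id hg
      (A := Finset.univ) (B := Finset.univ.image g) (by simp) (by simp), sq_abs]
  simp only [Function.comp_apply]
  ring

end CauchyBinet

/-! ### The determinant as a sum over rooted spanning forests -/

section SpanningForests

variable {V : Type*} [Fintype V] [DecidableEq V] (T : SimpleGraph V) [DecidableRel T.Adj]

/-- The oriented incidence matrix of `T`, for an arbitrary orientation, extended by an identity
matrix; columns of pairs that are not edges vanish. -/
noncomputable def extIncidence : Matrix V (Sym2 V ⊕ V) ℤ :=
  Matrix.of fun v => Sum.elim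
    (fun e => if e ∈ T.edgeFinset then
      (if v = (Quot.out e).1 then 1 else 0) - (if v = (Quot.out e).2 then 1 else 0) else 0)
    (fun u => if v = u then 1 else 0)

theorem extIncidence_inr (u : V) : (fun v => extIncidence T v (Sum.inr u)) = Pi.single u 1 := by
  ext v
  simp [extIncidence, Pi.single_apply]

theorem extIncidence_inl_of_notMem {e : Sym2 V} (he : e ∉ T.edgeFinset) (v : V) :
    extIncidence T v (Sum.inl e) = 0 := by
  simp only [extIncidence, of_apply, Sum.elim_inl, if_neg he]

/-- The sign `s` absorbs the arbitrary orientation; only its square matters later. -/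
theorem extIncidence_inl {a b : V} (h : T.Adj a b) : ∃ s : ℤ, s * s = 1 ∧
    ∀ v, extIncidence T v (Sum.inl s(a, b)) =
      s * ((if v = a then 1 else 0) - (if v = b then 1 else 0)) := by
  have h1 : s(a, b) ∈ T.edgeFinset := by simpa using h
  have h2 : s((Quot.out s(a, b)).1, (Quot.out s(a, b)).2) = s(a, b) := Quot.out_eq s(a, b)
  rw [Sym2.eq_iff] at h2
  rcases h2 with ⟨ha, hb⟩ | ⟨hb, ha⟩
  · exact ⟨1, by norm_num, fun v => by
      simp only [extIncidence, of_apply, Sum.elim_inl, if_pos h1, ha, hb]; ring⟩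
  · exact ⟨-1, by norm_num, fun v => by
      simp only [extIncidence, of_apply, Sum.elim_inl, if_pos h1, ha, hb]; ring⟩

/-- The edge part of the extended incidence matrix times its transpose is the Laplacian. -/
theorem sum_extIncidence_mul (v w : V) :
    ∑ e, extIncidence T v (Sum.inl e) * extIncidence T w (Sum.inl e) =
      if v = w then (T.degree v : ℤ) else if T.Adj v w then -1 else 0 := by
  split_ifs with hvw hadj
  · subst hvw
    have : ∀ e, extIncidence T v (Sum.inl e) * extIncidence T v (Sum.inl e) =
        if e ∈ T.incidenceFinset v then 1 else 0 := by
      intro e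
      induction e with
      | _ a b =>
        by_cases h : T.Adj a b
        · obtain ⟨s, hs, hv⟩ := extIncidence_inl T h
          have hne := h.ne
          rw [hv]
          by_cases h1 : v = a <;> by_cases h2 : v = b <;>
            simp_all [SimpleGraph.mem_incidenceFinset, SimpleGraph.mk'_mem_incidenceSet_iff]
        · rw [extIncidence_inl_of_notMem T (by simpa using h)]
          simp [SimpleGraph.mem_incidenceFinset, SimpleGraph.mk'_mem_incidenceSet_iff, h]
    simp only [this]
    rw [Finset.sum_boole, Finset.filter_mem_eq_inter, Finset.univ_inter,
      SimpleGraph.card_incidenceFinset_eq_degree]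
  · rw [Finset.sum_eq_single s(v, w)]
    · obtain ⟨s, hs, hv⟩ := extIncidence_inl T hadj
      rw [hv, hv]
      simp [hvw, Ne.symm hvw]
      linarith
    · intro e _ he
      induction e with
      | _ a b =>
        by_cases h : T.Adj a b
        · obtain ⟨s, hs, hv⟩ := extIncidence_inl T h
          rw [hv, hv]
          rw [Ne, Sym2.eq_iff] at he
          by_cases h1 : v = a <;> by_cases h2 : v = b <;> by_cases h3 : w = a <;>
            by_cases h4 : w = b <;> simp_all
        · rw [extIncidence_inl_of_notMem T (by simpa using h), zero_mul]
    · simp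
  · refine Finset.sum_eq_zero fun e _ => ?_
    induction e with
    | _ a b =>
      by_cases h : T.Adj a b
      · obtain ⟨s, hs, hv⟩ := extIncidence_inl T h
        have h' := h.symm
        rw [hv, hv]
        by_cases h1 : v = a <;> by_cases h2 : v = b <;> by_cases h3 : w = a <;>
          by_cases h4 : w = b <;> simp_all
      · rw [extIncidence_inl_of_notMem T (by simpa using h), zero_mul]

/-- As `trs = deg + c`, the matrix is the Laplacian plus `diag(c)`, the second summand coming from
the identity block. -/
theorem Atrs_eq_mul : Atrs T = extIncidence T *
    (extIncidence T * (diagonal (Sum.elim (fun _ => 1) (c T) : Sym2 V ⊕ V → ℤ) :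
      Matrix (Sym2 V ⊕ V) (Sym2 V ⊕ V) ℤ))ᵀ := by
  ext v w
  rw [Matrix.mul_apply, Fintype.sum_sum_type]
  simp only [transpose_apply, Matrix.mul_diagonal, Sum.elim_inl, Sum.elim_inr, mul_one]
  rw [sum_extIncidence_mul]
  have : ∀ u : V, extIncidence T v (Sum.inr u) * (extIncidence T w (Sum.inr u) * c T u) =
      if v = u then (if w = u then c T u else 0) else 0 := fun u => by
    simp only [extIncidence, of_apply, Sum.elim_inr]
    split_ifs <;> simp
  simp only [this, Finset.sum_ite_eq, Finset.mem_univ, if_true]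
  simp only [Atrs, Matrix.sub_apply, diagonal_apply, SimpleGraph.adjMatrix_apply, c]
  by_cases h : v = w
  · subst h; simp
  · by_cases h' : T.Adj v w <;> simp [h, Ne.symm h, h']

variable {T}

/-- Contracting the components leaves a connected graph whose edges all come from `F`. -/
theorem card_connectedComponent_deleteEdges_le (hT : T.Connected) (F : Finset (Sym2 V)) :
    Nat.card (T.deleteEdges (F : Set (Sym2 V))).ConnectedComponent ≤ F.card + 1 := by
  set G := T.deleteEdges (F : Set (Sym2 V)) with hG
  let H : SimpleGraph G.ConnectedComponent :=
    SimpleGraph.fromEdgeSet (Sym2.map G.connectedComponentMk '' (F : Set (Sym2 V)))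
  have hstep : ∀ a b, T.Adj a b →
      H.Reachable (G.connectedComponentMk a) (G.connectedComponentMk b) := by
    intro a b hab
    by_cases he : s(a, b) ∈ F
    · by_cases hne : G.connectedComponentMk a = G.connectedComponentMk b
      · rw [hne]
      · refine SimpleGraph.Adj.reachable ?_
        rw [SimpleGraph.fromEdgeSet_adj]
        exact ⟨⟨s(a, b), he, rfl⟩, hne⟩
    · have : G.Adj a b := by simp [hG, hab, he]
      rw [SimpleGraph.ConnectedComponent.eq.2 this.reachable]
  have hwalk : ∀ a b, T.Walk a b →
      H.Reachable (G.connectedComponentMk a) (G.connectedComponentMk b) := by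
    intro a b p
    induction p with
    | nil => exact SimpleGraph.Reachable.refl _
    | cons h _ ih => exact (hstep _ _ h).trans ih
  have hconn : H.Connected := by
    have := hT.nonempty
    have : Nonempty G.ConnectedComponent := ⟨G.connectedComponentMk (Classical.arbitrary V)⟩
    refine ⟨fun x y => ?_⟩
    induction x using SimpleGraph.ConnectedComponent.ind with
    | _ a => induction y using SimpleGraph.ConnectedComponent.ind with
      | _ b => exact hwalk a b (hT a b).some
  refine hconn.card_vert_le_card_edgeSet_add_one.trans (Nat.add_le_add_right ?_ 1)
  rw [Nat.card_coe_set_eq]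
  calc H.edgeSet.ncard ≤ (Sym2.map G.connectedComponentMk '' (F : Set (Sym2 V))).ncard := by
        refine Set.ncard_le_ncard ?_ (Set.toFinite _)
        rw [SimpleGraph.edgeSet_fromEdgeSet]
        exact Set.sdiff_subset
    _ ≤ (F : Set (Sym2 V)).ncard := Set.ncard_image_le (Set.toFinite _)
    _ = F.card := Set.ncard_coe_finset F

/-- The edge set `F` meets the path between any two distinct vertices of `U`. -/
def Separates (T : SimpleGraph V) (F : Finset (Sym2 V)) (U : Finset V) : Prop :=
  ∀ u ∈ U, ∀ v ∈ U, u ≠ v → (pathEdges T u v ∩ (F : Set (Sym2 V))).Nonempty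

/-- Separation puts the vertices of `U` in distinct components, and there are at most `|F| + 1 =
|U|` components, so each contains a vertex of `U`. -/
theorem Separates.exists_reachable (hT : T.IsTree) {F : Finset (Sym2 V)} {U : Finset V}
    (h : Separates T F U) (hc : F.card + 1 = U.card) (v : V) :
    ∃ u ∈ U, (T.deleteEdges (F : Set (Sym2 V))).Reachable u v := by
  classical
  set G := T.deleteEdges (F : Set (Sym2 V)) with hG
  have hinj : Set.InjOn G.connectedComponentMk (U : Set V) := by
    intro a ha b hb hab
    by_contra hne
    obtain ⟨p, hp⟩ := (SimpleGraph.ConnectedComponent.eq.1 hab).exists_isPath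
    obtain ⟨e, ⟨q, hq, heq⟩, heF⟩ := h a ha b hb hne
    have hle : G ≤ T := SimpleGraph.deleteEdges_le _
    have hpq : (p.mapLe hle) = q := by
      have := (hT.isAcyclic.subsingleton_path a b).elim ⟨p.mapLe hle, hp.mapLe hle⟩ ⟨q, hq⟩
      exact congrArg Subtype.val this
    rw [← hpq, SimpleGraph.Walk.edges_mapLe_eq_edges] at heq
    have := p.edges_subset_edgeSet heq
    rw [hG, SimpleGraph.edgeSet_deleteEdges] at this
    exact this.2 heF
  have : Fintype G.ConnectedComponent := Fintype.ofFinite _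
  have hsurj : U.image G.connectedComponentMk = Finset.univ := by
    rw [← Finset.card_eq_iff_eq_univ, Finset.card_image_of_injOn hinj]
    refine le_antisymm ?_ ?_
    · rw [← Finset.card_image_of_injOn hinj]; exact Finset.card_le_univ _
    · rw [← hc, ← Nat.card_eq_fintype_card]
      exact card_connectedComponent_deleteEdges_le hT.connected F
  have hv : G.connectedComponentMk v ∈ U.image G.connectedComponentMk := by
    rw [hsurj]; exact Finset.mem_univ _
  obtain ⟨u, hu, huv⟩ := Finset.mem_image.1 hv
  exact ⟨u, hu, SimpleGraph.ConnectedComponent.eq.1 huv⟩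

theorem extIncidence_inl_eq (a b : V) (h : T.Adj a b) : ∃ s : ℤ, s * s = 1 ∧
    (fun v => extIncidence T v (Sum.inl s(a, b))) = s • (Pi.single a 1 - Pi.single b 1) := by
  obtain ⟨s, hs, hv⟩ := extIncidence_inl T h
  refine ⟨s, hs, ?_⟩
  ext v
  simp [hv, Pi.single_apply]

/-- The incidence columns telescope along the walk. -/
theorem single_sub_single_mem_span {E : Set (Sym2 V)} {a b : V} (p : T.Walk a b)
    (hp : ∀ e ∈ p.edges, e ∈ E) : (Pi.single a 1 - Pi.single b 1 : V → ℤ) ∈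
      Submodule.span ℤ ((fun e v => extIncidence T v (Sum.inl e)) '' E) := by
  induction p with
  | nil => simp
  | @cons a u b h q ih =>
    have h1 := ih fun e he => hp e (by simp [he])
    obtain ⟨s, hs, hv⟩ := extIncidence_inl_eq a u h
    have h2 : (Pi.single a 1 - Pi.single u 1 : V → ℤ) ∈
        Submodule.span ℤ ((fun e v => extIncidence T v (Sum.inl e)) '' E) := by
      have h3 : (Pi.single a 1 - Pi.single u 1 : V → ℤ) =
          s • fun v => extIncidence T v (Sum.inl s(a, u)) := by
        rw [hv, smul_smul, hs, one_smul]
      rw [h3]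
      exact Submodule.smul_mem _ _ (Submodule.subset_span ⟨s(a, u), hp _ (by simp), rfl⟩)
    have h4 := add_mem h2 h1
    rwa [sub_add_sub_cancel] at h4

/-- A separating edge set of the right size yields a unimodular submatrix. -/
theorem Separates.absMinor_eq_one (hT : T.IsTree) {F : Finset (Sym2 V)} {U : Finset V}
    (h : Separates T F U) (hc : F.card + 1 = U.card)
    (hK : ((T.edgeFinset \ F).disjSum U).card = Fintype.card V) :
    absMinor (extIncidence T) Finset.univ ((T.edgeFinset \ F).disjSum U) = 1 := by
  obtain ⟨g, hg, hgK⟩ := exists_injective_image_eq (m := V) hK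
  have hmem : ∀ k, k ∈ (T.edgeFinset \ F).disjSum U ↔ ∃ i, g i = k := by
    intro k; rw [← hgK]; simp
  rw [← abs_det_submatrix_eq_absMinor' _ (f := id) (g := g) Function.injective_id hg
    (by simp) hmem, ← Int.isUnit_iff_abs_eq, ← Matrix.isUnit_iff_isUnit_det,
    ← Matrix.mulVec_surjective_iff_isUnit]
  -- The columns span over the integers: each vertex `v` is joined to some root `u` by kept edges,
  -- and `e_v = (e_v - e_u) + e_u`.
  have hr : LinearMap.range ((extIncidence T).submatrix id g).mulVecLin = ⊤ := by
    rw [Matrix.range_mulVecLin, eq_top_iff, ← (Pi.basisFun ℤ V).span_eq, Submodule.span_le]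
    rintro _ ⟨v, rfl⟩
    obtain ⟨u, hu, hreach⟩ := h.exists_reachable hT hc v
    obtain ⟨p⟩ := hreach.symm
    have hle : T.deleteEdges (F : Set (Sym2 V)) ≤ T := SimpleGraph.deleteEdges_le _
    have h1 := single_sub_single_mem_span (E := ((T.edgeFinset \ F : Finset (Sym2 V)) : Set _))
      (p.mapLe hle) (fun e he => by
        rw [SimpleGraph.Walk.edges_mapLe_eq_edges] at he
        have := p.edges_subset_edgeSet he
        rw [SimpleGraph.edgeSet_deleteEdges] at this
        simpa using this)
    have h2 : (Pi.single u 1 : V → ℤ) ∈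
        Submodule.span ℤ (Set.range ((extIncidence T).submatrix id g).col) := by
      obtain ⟨i, hi⟩ := (hmem (Sum.inr u)).1 (by simpa using hu)
      refine Submodule.subset_span ⟨i, ?_⟩
      rw [← extIncidence_inr T u, ← hi]; rfl
    have h3 : Submodule.span ℤ ((fun e v => extIncidence T v (Sum.inl e)) ''
        ((T.edgeFinset \ F : Finset (Sym2 V)) : Set _)) ≤
        Submodule.span ℤ (Set.range ((extIncidence T).submatrix id g).col) := by
      refine Submodule.span_mono ?_
      rintro _ ⟨e, he, rfl⟩
      obtain ⟨i, hi⟩ := (hmem (Sum.inl e)).1 (by simpa using he)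
      exact ⟨i, funext fun w => congrArg (extIncidence T w) hi⟩
    have h4 := add_mem (h3 h1) h2
    rw [sub_add_cancel] at h4
    simpa [Pi.basisFun_apply] using h4
  exact LinearMap.range_eq_top.1 hr

/-- A nonsingular maximal submatrix comes from a separating edge set. -/
theorem separates_of_absMinor_ne_zero (hT : T.IsTree) {K : Finset (Sym2 V ⊕ V)}
    (hK : K.card = Fintype.card V) (h0 : absMinor (extIncidence T) Finset.univ K ≠ 0) :
    K.toLeft ⊆ T.edgeFinset ∧ Separates T (T.edgeFinset \ K.toLeft) K.toRight := by
  obtain ⟨g, hg, hgK⟩ := exists_injective_image_eq (m := V) hK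
  have hmem : ∀ k, k ∈ K ↔ ∃ i, g i = k := by
    intro k; rw [← hgK]; simp
  rw [← abs_det_submatrix_eq_absMinor' _ (f := id) (g := g) Function.injective_id hg
    (by simp) hmem, abs_ne_zero] at h0
  have hsub : K.toLeft ⊆ T.edgeFinset := by
    intro e he
    by_contra heT
    obtain ⟨i, hi⟩ := (hmem (Sum.inl e)).1 (by simpa using he)
    refine h0 (det_eq_zero_of_column_eq_zero i fun j => ?_)
    rw [submatrix_apply, hi]
    exact extIncidence_inl_of_notMem T heT _
  refine ⟨hsub, fun u hu v hv huv => ?_⟩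
  by_contra hemp
  rw [Set.not_nonempty_iff_eq_empty, Set.eq_empty_iff_forall_notMem] at hemp
  obtain ⟨p, hp⟩ := (hT.connected u v).exists_isPath
  have hli := linearIndependent_cols_of_det_ne_zero h0
  have h1 := single_sub_single_mem_span (E := (K.toLeft : Set (Sym2 V))) p fun e he => by
    by_contra heK
    refine hemp e ⟨⟨p, hp, he⟩, ?_⟩
    simp only [Finset.coe_sdiff, Set.mem_sdiff, Finset.mem_coe] at heK ⊢
    exact ⟨by simpa using p.edges_subset_edgeSet he, heK⟩
  -- If the path from `u` to `v` avoided the deleted edges, `e_u - e_v` would be a nonzero vector in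
  -- the span of both the edge columns and the root columns, against independence.
  have hdisj := hli.disjoint_span_image
    (s := {i | ∃ e, g i = Sum.inl e}) (t := {i | ∃ w, g i = Sum.inr w}) (by
      rw [Set.disjoint_left]
      rintro i ⟨e, he⟩ ⟨w, hw⟩
      rw [he] at hw
      cases hw)
  have h2 : (Pi.single u 1 - Pi.single v 1 : V → ℤ) ∈ Submodule.span ℤ
      (((extIncidence T).submatrix id g).col '' {i | ∃ e, g i = Sum.inl e}) := by
    refine Submodule.span_mono ?_ h1
    rintro _ ⟨e, he, rfl⟩
    obtain ⟨i, hi⟩ := (hmem (Sum.inl e)).1 (by simpa using he)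
    exact ⟨i, ⟨e, hi⟩, funext fun w => congrArg (extIncidence T w) hi⟩
  have h3 : ∀ w ∈ K.toRight, (Pi.single w 1 : V → ℤ) ∈ Submodule.span ℤ
      (((extIncidence T).submatrix id g).col '' {i | ∃ w, g i = Sum.inr w}) := by
    intro w hw
    obtain ⟨i, hi⟩ := (hmem (Sum.inr w)).1 (by simpa using hw)
    refine Submodule.subset_span ⟨i, ⟨w, hi⟩, ?_⟩
    rw [← extIncidence_inr T w, ← hi]; rfl
  have h4 := Submodule.disjoint_def.1 hdisj _ h2 (sub_mem (h3 u hu) (h3 v hv))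
  have h5 := congrFun h4 u
  simp [huv] at h5

theorem det_Atrs_eq_sum (hT : T.IsTree) :
    (Atrs T).det = ∑ U ∈ Finset.univ.filter (fun U : Finset V => U.Nonempty),
      (rho T U : ℤ) * ∏ u ∈ U, c T u := by
  classical
  rw [Atrs_eq_mul, det_mul_diagonal_mul_transpose]
  have hE : T.edgeFinset.card + 1 = Fintype.card V := hT.card_edgeFinset
  have h1 : ∀ U ∈ Finset.univ.filter (fun U : Finset V => U.Nonempty),
      (rho T U : ℤ) * ∏ u ∈ U, c T u = ∑ F ∈ Finset.univ.filter (fun F : Finset (Sym2 V) =>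
        F ⊆ T.edgeFinset ∧ F.card + 1 = U.card ∧ Separates T F U), ∏ u ∈ U, c T u := by
    intro U _
    rw [Finset.sum_const, nsmul_eq_mul]
    congr 2
    unfold rho
    congr 1
    ext F
    rw [Finset.mem_filter, Finset.mem_filter, ← Finset.coe_subset, SimpleGraph.coe_edgeFinset]
    rfl
  rw [Finset.sum_congr rfl h1, Finset.sum_sigma']
  symm
  have hcard : ∀ (U : Finset V) (F : Finset (Sym2 V)), F ⊆ T.edgeFinset → F.card + 1 = U.card →
      ((T.edgeFinset \ F).disjSum U).card = Fintype.card V := by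
    intro U F hF hc
    have h2 := Finset.card_le_card hF
    rw [Finset.card_disjSum, Finset.card_sdiff_of_subset hF]
    omega
  refine Finset.sum_of_injOn (fun p => (T.edgeFinset \ p.2).disjSum p.1) ?_ ?_ ?_ ?_
  · rintro ⟨U, F⟩ hp ⟨U', F'⟩ hp' heq
    simp only [Finset.coe_sigma, Set.mem_sigma_iff, Finset.mem_coe, Finset.mem_filter,
      Finset.mem_univ, true_and] at hp hp'
    have hl := congrArg Finset.toLeft heq
    have hr := congrArg Finset.toRight heq
    simp only [Finset.toLeft_disjSum, Finset.toRight_disjSum] at hl hr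
    subst hr
    have : F = F' := by
      rw [← Finset.sdiff_sdiff_eq_self hp.2.1, hl, Finset.sdiff_sdiff_eq_self hp'.2.1]
    rw [this]
  · rintro ⟨U, F⟩ hp
    simp only [Finset.coe_sigma, Set.mem_sigma_iff, Finset.mem_coe, Finset.mem_filter,
      Finset.mem_univ, true_and] at hp
    simp only [Finset.mem_coe, Finset.mem_powersetCard]
    exact ⟨Finset.subset_univ _, hcard U F hp.2.1 hp.2.2.1⟩
  -- Column sets that do not come from a separating pair contribute zero.
  · intro K hK hn
    have hKc := (Finset.mem_powersetCard.1 hK).2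
    by_contra hne
    have h0 : absMinor (extIncidence T) Finset.univ K ≠ 0 := fun h0 => hne (by rw [h0]; ring)
    obtain ⟨hs, hsep⟩ := separates_of_absMinor_ne_zero hT hKc h0
    refine hn ⟨⟨K.toRight, T.edgeFinset \ K.toLeft⟩, ?_, ?_⟩
    · have h2 := Finset.card_toLeft_add_card_toRight (u := K)
      have h3 := Finset.card_le_card hs
      have h4 := Finset.card_sdiff_of_subset hs
      simp only [Finset.coe_sigma, Set.mem_sigma_iff, Finset.mem_coe, Finset.mem_filter,
        Finset.mem_univ, true_and]
      -- The root set is nonempty because a tree has fewer edges than `K` has elements.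
      exact ⟨Finset.card_pos.1 (by omega), Finset.sdiff_subset, by omega, hsep⟩
    · simp only
      rw [Finset.sdiff_sdiff_eq_self hs, Finset.toLeft_disjSum_toRight]
  · rintro ⟨U, F⟩ hp
    simp only [Finset.mem_sigma, Finset.mem_filter, Finset.mem_univ, true_and] at hp
    simp only
    rw [hp.2.2.2.absMinor_eq_one hT hp.2.2.1 (hcard U F hp.2.1 hp.2.2.1), Finset.prod_disjSum]
    simp

end SpanningForests

/-! ### Transmission matrices: positivity, signs and the divisors `Delta` -/

section Transmission

variable {V : Type*} [Fintype V] [DecidableEq V] {T : SimpleGraph V} [DecidableRel T.Adj]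

theorem isGraphMatrix_Atrs : IsGraphMatrix T (Atrs T) where
  transpose := by
    rw [Atrs, transpose_sub, diagonal_transpose, SimpleGraph.transpose_adjMatrix]
  adj a b h := by
    simp [Atrs, SimpleGraph.adjMatrix_apply, h, h.ne]
  not_adj a b hne h := by
    simp [Atrs, SimpleGraph.adjMatrix_apply, h, hne]

/-- Each summand is nonnegative, and positive at vertices other than `u` at finite distance and not
adjacent to it. -/
theorem c_eq_sum (u : V) :
    c T u = ∑ v, ((T.dist u v : ℤ) - if T.Adj u v then 1 else 0) := by
  have h : ∑ v, (if T.Adj u v then (1 : ℤ) else 0) = T.degree u := by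
    rw [Finset.sum_boole, ← SimpleGraph.card_neighborFinset_eq_degree,
      SimpleGraph.neighborFinset_eq_filter]
  rw [Finset.sum_sub_distrib, h, c, trs]
  push_cast
  rfl

theorem dist_sub_adj_nonneg (u v : V) : 0 ≤ (T.dist u v : ℤ) - if T.Adj u v then 1 else 0 := by
  split_ifs with h
  · rw [SimpleGraph.dist_eq_one_iff_adj.2 h]; simp
  · simp

theorem c_nonneg (u : V) : 0 ≤ c T u := by
  rw [c_eq_sum]
  exact Finset.sum_nonneg fun v _ => dist_sub_adj_nonneg u v

theorem c_pos (hT : T.IsTree) {u v : V} (hne : u ≠ v) (h : ¬ T.Adj u v) : 0 < c T u := by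
  rw [c_eq_sum]
  refine Finset.sum_pos' (fun v _ => dist_sub_adj_nonneg u v) ⟨v, Finset.mem_univ v, ?_⟩
  rw [if_neg h]
  have := hT.connected.pos_dist_of_ne hne
  omega

/-- Otherwise three vertices would form a triangle, while in a tree adjacent vertices have different
distances from any third one. -/
theorem exists_ne_not_adj (hT : T.IsTree) (hn : 3 ≤ Fintype.card V) :
    ∃ u v, u ≠ v ∧ ¬ T.Adj u v := by
  obtain ⟨a, b, e, hab, hae, hbe⟩ := Fintype.two_lt_card_iff.1 hn
  by_contra! h
  refine hT.dist_ne_of_adj a (h b e hbe) ?_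
  rw [SimpleGraph.dist_eq_one_iff_adj.2 (h a b hab), SimpleGraph.dist_eq_one_iff_adj.2 (h a e hae)]

theorem rho_singleton_pos (u : V) : 0 < rho T {u} := by
  unfold rho
  refine Finset.card_pos.2 ⟨∅, ?_⟩
  simp

/-- All terms of the forest expansion are nonnegative, and a single root `u` with `c(u) > 0` and `F
= ∅` gives a positive one. -/
theorem det_Atrs_pos (hT : T.IsTree) (hn : 3 ≤ Fintype.card V) : 0 < (Atrs T).det := by
  obtain ⟨u, v, hne, hadj⟩ := exists_ne_not_adj hT hn
  rw [det_Atrs_eq_sum hT]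
  refine Finset.sum_pos' (fun U _ => mul_nonneg (by positivity)
    (Finset.prod_nonneg fun u _ => c_nonneg u)) ⟨{u}, by simp, ?_⟩
  rw [Finset.prod_singleton]
  exact mul_pos (by exact_mod_cast rho_singleton_pos u) (c_pos hT hne hadj)

theorem det_Atrs_eq_sum_powersetCard (hT : T.IsTree) : (Atrs T).det =
    ∑ a ∈ Finset.Icc 1 (Fintype.card V), ∑ U ∈ Finset.powersetCard a (Finset.univ : Finset V),
      (rho T U : ℤ) * ∏ u ∈ U, c T u := by
  rw [det_Atrs_eq_sum hT, ← Finset.sum_fiberwise_of_maps_to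
    (t := Finset.Icc 1 (Fintype.card V)) (g := Finset.card)]
  · refine Finset.sum_congr rfl fun a ha => Finset.sum_congr ?_ fun _ _ => rfl
    rw [Finset.mem_Icc] at ha
    ext U
    simp only [Finset.mem_filter, Finset.mem_univ, true_and, Finset.mem_powersetCard,
      Finset.subset_univ, and_iff_right_iff_imp]
    intro h
    exact Finset.card_pos.1 (by omega)
  · intro U hU
    rw [Finset.mem_Icc]
    exact ⟨Finset.card_pos.2 (Finset.mem_filter.1 hU).2, Finset.card_le_univ U⟩

/-- Conjugation by the signs of the bipartition turns `Atrs` into `AtrsPlus`. -/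
theorem exists_sign_AtrsPlus_eq (hT : T.IsTree) : ∃ s : V → ℤ, (∀ v, s v * s v = 1) ∧
    AtrsPlus T = diagonal s * Atrs T * diagonal s := by
  obtain ⟨r⟩ := hT.connected.nonempty
  have hs : ∀ v, (-1 : ℤ) ^ T.dist r v * (-1) ^ T.dist r v = 1 := fun v => by
    rw [← mul_pow]; norm_num
  refine ⟨fun v => (-1) ^ T.dist r v, hs, ?_⟩
  ext v w
  rw [mul_diagonal, diagonal_mul]
  simp only [AtrsPlus, Atrs, Matrix.add_apply, Matrix.sub_apply, diagonal_apply,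
    SimpleGraph.adjMatrix_apply]
  by_cases hvw : v = w
  · subst hvw
    have h := hs v
    simp only [if_true, SimpleGraph.irrefl, if_false]
    linear_combination (-(trs T v : ℤ)) * h
  · by_cases hadj : T.Adj v w
    · have h := hs v
      have h' := hs w
      simp only [hvw, hadj, if_true, if_false]
      -- Distances from the root differ by one along an edge, so the two signs are opposite.
      rcases hT.dist_eq_dist_add_one_of_adj r hadj with hd | hd
      · rw [hd, pow_succ]; linear_combination -h'
      · rw [hd, pow_succ]; linear_combination -h
    · simp [hvw, hadj]

variable {n : ℕ}

/-- The divisors `Delta` are the determinantal divisors. -/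
theorem dvd_Delta_iff (hT : T.IsTree) (e : V ≃ Fin n) (k : ℕ) (z : ℤ) :
    z ∣ Delta T k ↔ ∀ f g : Fin k → Fin n, z ∣ ((reindex e e (Atrs T)).submatrix f g).det := by
  rw [Delta, ← forall_dvd_minor_iff hT isGraphMatrix_Atrs]
  constructor
  · intro h f g
    exact h (e.symm ∘ f) (e.symm ∘ g)
  · intro h f g
    have := h (e ∘ f) (e ∘ g)
    rwa [reindex_apply, submatrix_submatrix, ← Function.comp_assoc, ← Function.comp_assoc,
      Equiv.symm_comp_self, Function.id_comp, Function.id_comp] at this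

theorem Delta_nonneg (k : ℕ) : 0 ≤ Delta T k := by
  unfold Delta
  rw [← Finset.normalize_gcd, ← Int.abs_eq_normalize]
  exact abs_nonneg _

/-- Up to sign and repeated indices there is only one minor of order `n`; positivity of the
determinant fixes the sign. -/
theorem Delta_card (hT : T.IsTree) (hcard : Fintype.card V = n) (hn : 3 ≤ n) :
    Delta T n = (Atrs T).det := by
  have e : V ≃ Fin n := Fintype.equivFinOfCardEq hcard
  have hpos := det_Atrs_pos hT (hcard ▸ hn)
  refine Int.dvd_antisymm (Delta_nonneg n) hpos.le ?_ ?_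
  · have := (dvd_Delta_iff hT e n _).1 dvd_rfl id id
    rwa [submatrix_id_id, det_reindex_self] at this
  · rw [dvd_Delta_iff hT e, forall_dvd_det_submatrix_iff]
    intro A B hA hB
    have hA' : A = Finset.univ := (Finset.card_eq_iff_eq_univ A).1 (by simp [hA])
    have hB' : B = Finset.univ := (Finset.card_eq_iff_eq_univ B).1 (by simp [hB])
    rw [← abs_det_submatrix_eq_absMinor' _ (f := id) (g := id) Function.injective_id
      Function.injective_id (by simp [hA']) (by simp [hB']), submatrix_id_id, det_reindex_self,
      dvd_abs]

/-- The first two edges of the path between nonadjacent vertices form a 2-matching without loops,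
whose minor is the empty determinant. -/
theorem Delta_two (hT : T.IsTree) (hn : 3 ≤ Fintype.card V) : Delta T 2 = 1 := by
  obtain ⟨u, v, hne, hadj⟩ := exists_ne_not_adj hT hn
  obtain ⟨x, hux, hx⟩ := exists_adj_dist_add_one hT hne
  have hxv : x ≠ v := by rintro rfl; exact hadj hux
  obtain ⟨y, hxy, hy⟩ := exists_adj_dist_add_one hT hxv
  have huy : u ≠ y := by rintro rfl; omega
  have hne' : s(u, x) ≠ s(x, y) := by
    rw [Ne, Sym2.eq_iff]
    rintro (⟨h, -⟩ | ⟨h, -⟩)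
    · exact hux.ne h
    · exact huy h
  have h1 : IsTwoMatching T {s(x, y)} := by
    have h0 : IsTwoMatching T ∅ := ⟨by simp, by simp⟩
    exact h0.insert_edge hxy (by simp [inc]) (by simp [inc])
  have h2 : IsTwoMatching T {s(u, x), s(x, y)} := by
    refine h1.insert_edge hux ?_ ?_
    · simp [inc, incidences_mk, huy, hux.ne]
    · simp [inc, incidences_mk, hxy.ne]
  have hl : loops {s(u, x), s(x, y)} = (∅ : Finset V) := by
    rw [loops_insert_edge hux.ne]
    ext w
    simp only [mem_loops, Finset.mem_singleton, Sym2.eq_iff, Finset.notMem_empty, iff_false]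
    rintro (⟨rfl, rfl⟩ | ⟨rfl, rfl⟩) <;> exact hxy.ne rfl
  obtain ⟨A, B, hA, hB, -, hm⟩ := exists_absMinor_eq_of_twoMatching hT
    (isGraphMatrix_Atrs (T := T)) 2 _ h2 (Finset.card_pair hne')
  rw [hl, absMinor_empty] at hm
  have hall := (forall_dvd_minor_iff hT (isGraphMatrix_Atrs (T := T)) 2 (Delta T 2)).2 dvd_rfl
  rw [forall_dvd_det_submatrix_iff] at hall
  have h3 := hall A B hA hB
  rw [hm] at h3
  exact Int.eq_one_of_dvd_one (Delta_nonneg 2) h3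

end Transmission

/-! ### Reading off the Smith normal form -/

section Assembly

variable {V : Type*} [Fintype V] [DecidableEq V] {T : SimpleGraph V} [DecidableRel T.Adj] {n : ℕ}

/-- Both sides are nonnegative and have the same divisors, since the common divisors of the minors
of order `k` are invariant under equivalence. -/
theorem Delta_eq_prod (hT : T.IsTree) (e : V ≃ Fin n) {d : Fin n → ℤ}
    (hd : MatEquiv (reindex e e (Atrs T)) (diagonal d)) (h0 : ∀ i, 0 ≤ d i)
    (hdd : ∀ i j, i ≤ j → d i ∣ d j) {k : ℕ} (hk : k ≤ n) :
    Delta T k = ∏ i : Fin k, d (Fin.castLE hk i) := by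
  have key : ∀ z : ℤ, z ∣ Delta T k ↔ z ∣ ∏ i : Fin k, d (Fin.castLE hk i) := fun z => by
    rw [dvd_Delta_iff hT e, ← forall_dvd_minor_diagonal_iff hk hdd]
    exact ⟨fun h => hd.dvd_minor h, fun h => hd.symm.dvd_minor h⟩
  exact Int.dvd_antisymm (Delta_nonneg k) (Finset.prod_nonneg fun i _ => h0 _)
    ((key _).1 dvd_rfl) ((key _).2 dvd_rfl)

/-- The diagonal entries of the Smith normal form of `Atrs T`. -/
theorem exists_matEquiv_snfEntries (hT : T.IsTree) (e : V ≃ Fin n) (hcard : Fintype.card V = n)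
    (hn : 3 ≤ n) :
    MatEquiv (reindex e e (Atrs T)) (diagonal (snfEntries T n)) ∧
      (∀ i, 0 ≤ snfEntries T n i) ∧ (∀ i j, i ≤ j → snfEntries T n i ∣ snfEntries T n j) ∧
      (∀ k, k ≤ n → 0 < Delta T k) ∧ ∀ k, k < n → Delta T k ∣ Delta T (k + 1) := by
  obtain ⟨d, hd, h0, hdd⟩ := exists_smithNormalForm (reindex e e (Atrs T))
  have hprod := fun k (hk : k ≤ n) => Delta_eq_prod hT e hd h0 hdd hk
  have hstep : ∀ k (hk : k < n), Delta T (k + 1) = Delta T k * d ⟨k, hk⟩ := by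
    intro k hk
    rw [hprod (k + 1) hk, hprod k hk.le, Fin.prod_univ_castSucc]
    rfl
  have hdpos : ∀ i, 0 < d i := by
    intro i
    refine lt_of_le_of_ne (h0 i) fun hi => ?_
    have hpos := det_Atrs_pos hT (hcard ▸ hn)
    rw [← Delta_card hT hcard hn, hprod n le_rfl,
      Finset.prod_eq_zero (Finset.mem_univ i) (by simpa using hi.symm)] at hpos
    exact lt_irrefl _ hpos
  have hDpos : ∀ k, k ≤ n → 0 < Delta T k := fun k hk => by
    rw [hprod k hk]
    exact Finset.prod_pos fun i _ => hdpos _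
  have hD0 : Delta T 0 = 1 := by rw [hprod 0 (Nat.zero_le n)]; simp
  -- The product of the first two invariant factors is `Delta T 2 = 1`; being nonnegative integers,
  -- both are 1.
  have hD2 : d ⟨0, by omega⟩ * d ⟨1, by omega⟩ = 1 := by
    have h2 := Delta_two hT (hcard ▸ hn)
    rwa [hstep 1 (by omega), hstep 0 (by omega), hD0, one_mul] at h2
  have hd0 : d ⟨0, by omega⟩ = 1 := Int.eq_one_of_mul_eq_one_right (h0 _) hD2
  have hd1 : d ⟨1, by omega⟩ = 1 := Int.eq_one_of_mul_eq_one_left (h0 _) hD2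
  have hsnf : snfEntries T n = d := by
    funext ⟨i, hi⟩
    unfold snfEntries
    simp only
    split_ifs with h1 h2
    · interval_cases i
      · exact hd0.symm
      · exact hd1.symm
    · subst h2
      rw [hstep 2 hi, Delta_two hT (hcard ▸ hn), one_mul]
    · rw [hstep i hi, Int.mul_ediv_cancel_left _ (hDpos i hi.le).ne']
  rw [hsnf]
  exact ⟨hd, h0, hdd, hDpos, fun k hk => ⟨_, hstep k hk⟩⟩

theorem matEquiv_AtrsPlus (hT : T.IsTree) (e : V ≃ Fin n) :
    MatEquiv (reindex e e (AtrsPlus T)) (reindex e e (Atrs T)) := by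
  obtain ⟨s, hs, h⟩ := exists_sign_AtrsPlus_eq hT
  have hu : ∀ i, s (e.symm i) * s (e.symm i) = 1 := fun i => hs _
  let S : GL (Fin n) ℤ := ⟨diagonal fun i => s (e.symm i), diagonal fun i => s (e.symm i),
    by simp [diagonal_mul_diagonal, hu], by simp [diagonal_mul_diagonal, hu]⟩
  refine MatEquiv.symm ⟨S, S, ?_⟩
  ext i j
  rw [h]
  simp [S, mul_diagonal, diagonal_mul]

end Assembly

end TreeSNF

theorem theorem4p3 {V : Type*} [Fintype V] [DecidableEq V] (T : SimpleGraph V)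
    [DecidableRel T.Adj] (hT : T.IsTree) (n : ℕ) (hcard : Fintype.card V = n) (hn : 3 ≤ n) :
    (∀ k, 3 ≤ k → k ≤ n → 0 < TreeSNF.Delta T k) ∧
    (∀ k, 3 ≤ k → k < n → TreeSNF.Delta T k ∣ TreeSNF.Delta T (k + 1)) ∧
    TreeSNF.IsSmithNormalForm (TreeSNF.Atrs T) (TreeSNF.snfEntries T n) ∧
    TreeSNF.IsSmithNormalForm (TreeSNF.AtrsPlus T) (TreeSNF.snfEntries T n) ∧
    TreeSNF.Delta T n =
      ∑ a ∈ Finset.Icc 1 n, ∑ U ∈ Finset.powersetCard a (Finset.univ : Finset V),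
        (TreeSNF.rho T U : ℤ) * ∏ u ∈ U, TreeSNF.c T u := by
  have e : V ≃ Fin n := Fintype.equivFinOfCardEq hcard
  obtain ⟨hM, h0, hdd, hpos, hdvd⟩ := TreeSNF.exists_matEquiv_snfEntries hT e hcard hn
  have hdd' : ∀ i j : Fin n, (i : ℕ) + 1 = (j : ℕ) →
      TreeSNF.snfEntries T n i ∣ TreeSNF.snfEntries T n j := fun i j hij =>
    hdd i j (Fin.le_def.2 (by omega))
  refine ⟨fun k _ hk => hpos k hk, fun k _ hk => hdvd k hk, ⟨h0, hdd', e, hM⟩,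
    ⟨h0, hdd', e, (TreeSNF.matEquiv_AtrsPlus hT e).trans hM⟩, ?_⟩
  rw [TreeSNF.Delta_card hT hcard hn, TreeSNF.det_Atrs_eq_sum_powersetCard hT, hcard]
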